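/- Definitions. Let $(M,\omega)$ be a connected symplectic 4-manifold with $c_1(M,\omega)=0$. A special Hamiltonian $S^1$-action on $(M,\omega)$ is a smooth effective action $G$ of $S^1=\mathbb{R}/2\pi\mathbb{Z}$ on $M$ with nonempty fixed point set $\mathrm{Fix}(G)$ such that: (a) $G$ is Hamiltonian: there is a smooth function $h:M\to\mathbb{R}$ with $\omega(X,\cdot)=-dh$, where $X$ is the vector field that generates $G$; (b) (Maslov condition) for every $p\in M\setminus\mathrm{Fix}(G)$ the orbit $C$ of $p$, traversed once in the direction of $X$, is the boundary of a smooth disc $\psi:D\to M$, and for each such disc, each symplectic trivialization $\psi^*TM\cong D\times\mathbb{C}^2$ and each $v\in T_pM\setminus\mathbb{R}X_p$ with $\omega(X_p,v)=0$, the $G$-invariant Lagrangian plane field along $C$ obtained by transporting $\mathrm{span}_{\mathbb{R}}(X_p,v)$ by $G$ has Maslov index $0$. Here the Maslov index of a loop of Lagrangian planes in $\mathbb{C}^2$ is the degree of $\det^2(A)$, where $A$ is a continuous field of unitary matrices whose columns span the planes over $\mathbb{R}$. Proposition. Let $n\ge 0$ be an integer, let $W_n=\{(z_1,z_2,z_3)\in\mathbb{C}^3: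 z_1^2+z_2^2+z_3^{n+1}=1\}$, and let $\omega_n$ be the restriction to $W_n$ of the standard symplectic form $\sum_{j=1}^3 dx_j\wedge dy_j$, where $z_j=x_j+iy_j$. Let $\tilde G$ be the $S^1$-action on $\mathbb{C}^3$ given by $$(z_1,z_2,z_3)\mapsto (z_1\cos\theta-z_2\sin\theta,\ z_1\sin\theta+z_2\cos\theta,\ z_3),\qquad \theta\in\mathbb{R}/2\pi\mathbb{Z}.$$ Then $\tilde G$ preserves $W_n$; $(W_n,\omega_n)$ is a connected symplectic 4-manifold with $c_1(W_n,\omega_n)=0$; and the restriction of $\tilde G$ to $(W_n,\omega_n)$ is a special Hamiltonian $S^1$-action. It has exactly $n+1$ fixed points, namely $(0,0,\xi^k)$ for $k=0,\dots,n$, where $\xi=e^{2\pi i/(n+1)}$. -/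

import Mathlib

open scoped ContDiff

noncomputable section

namespace SpecialHam

/-- The standard symplectic form `∑ dx_j ∧ dy_j` on `ℂ^N`, where `z_j = x_j + i y_j`. -/
def stdForm {N : ℕ} (u v : Fin N → ℂ) : ℝ :=
  ∑ j, ((u j).re * (v j).im - (u j).im * (v j).re)

/-- `M` is an embedded smooth submanifold of `ℂ^N` of real dimension `d`:
locally the zero set of a smooth submersion to `ℝ^k`, with `k + d = 2 N`. -/
def IsSmoothSubmanifold {N : ℕ} (d : ℕ) (M : Set (Fin N → ℂ)) : Prop :=
  ∀ p ∈ M, ∃ (U : Set (Fin N → ℂ)) (k : ℕ) (F : (Fin N → ℂ) → (Fin k → ℝ)),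
    IsOpen U ∧ p ∈ U ∧ k + d = 2 * N ∧ ContDiffOn ℝ ∞ F U ∧
      (∀ x ∈ U, x ∈ M ↔ F x = 0) ∧ ∀ x ∈ U, Function.Surjective (fderiv ℝ F x)

/-- The tangent space `T_p M` of a submanifold `M ⊆ ℂ^N`: velocities of curves in `M` through `p`. -/
def tangentVectors {N : ℕ} (M : Set (Fin N → ℂ)) (p : Fin N → ℂ) : Set (Fin N → ℂ) :=
  {v | ∃ γ : ℝ → (Fin N → ℂ), (∀ t, γ t ∈ M) ∧ γ 0 = p ∧ HasDerivAt γ v 0}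

/-- `M` is a symplectic 4-manifold for the restriction of the standard form of `ℂ^N`.
(The restriction of a closed form is closed, so only nondegeneracy has to be required.) -/
structure IsSymplecticFourManifold {N : ℕ} (M : Set (Fin N → ℂ)) : Prop where
  submanifold : IsSmoothSubmanifold 4 M
  nondegenerate : ∀ p ∈ M, ∀ u ∈ tangentVectors M p, u ≠ 0 →
    ∃ v ∈ tangentVectors M p, stdForm u v ≠ 0

/-- `c₁(M, ω) = 0`: for a smooth `ω`-compatible almost complex structure `J` on `TM`, the
complex line bundle `Λ²_ℂ T*M`, the dual of the determinant bundle of the rank 2 complex bundle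
`(TM, J)`, is trivial, that is, has a smooth nowhere vanishing section `Ω`. Only the
restrictions of `J p` and `Ω p` to `T_p M` matter. -/
def FirstChernClassVanishes {N : ℕ} (M : Set (Fin N → ℂ)) : Prop :=
  ∃ (J : (Fin N → ℂ) → ((Fin N → ℂ) →L[ℝ] (Fin N → ℂ)))
    (Ω : (Fin N → ℂ) → ((Fin N → ℂ) →L[ℝ] (Fin N → ℂ) →L[ℝ] ℂ)),
    ContDiffOn ℝ ∞ J M ∧ ContDiffOn ℝ ∞ Ω M ∧
    ∀ p ∈ M,
      (∀ v ∈ tangentVectors M p, J p v ∈ tangentVectors M p ∧ J p (J p v) = -v) ∧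
      (∀ u ∈ tangentVectors M p, ∀ v ∈ tangentVectors M p,
        stdForm (J p u) (J p v) = stdForm u v) ∧
      (∀ v ∈ tangentVectors M p, v ≠ 0 → 0 < stdForm v (J p v)) ∧
      (∀ v ∈ tangentVectors M p, Ω p v v = 0) ∧
      (∀ u ∈ tangentVectors M p, ∀ v ∈ tangentVectors M p,
        Ω p (J p u) v = Complex.I * Ω p u v) ∧
      (∃ u ∈ tangentVectors M p, ∃ v ∈ tangentVectors M p, Ω p u v ≠ 0)

/-- `ρ` restricts to a smooth action of `S¹ = ℝ/2πℤ` on `M`. (On a submanifold `M`, `ContDiffOn`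
over `M` is the usual smoothness of maps defined on `M`.) -/
structure IsSmoothCircleAction {N : ℕ} (M : Set (Fin N → ℂ))
    (ρ : Real.Angle → (Fin N → ℂ) → (Fin N → ℂ)) : Prop where
  mapsTo : ∀ θ, ∀ p ∈ M, ρ θ p ∈ M
  zero_act : ∀ p ∈ M, ρ 0 p = p
  add_act : ∀ θ θ', ∀ p ∈ M, ρ (θ + θ') p = ρ θ (ρ θ' p)
  smooth : ContDiffOn ℝ ∞ (fun x : ℝ × (Fin N → ℂ) => ρ (x.1 : Real.Angle) x.2)
    (Set.univ ×ˢ M)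

/-- `Fix(G)`. -/
def fixedPoints {N : ℕ} (M : Set (Fin N → ℂ))
    (ρ : Real.Angle → (Fin N → ℂ) → (Fin N → ℂ)) : Set (Fin N → ℂ) :=
  {p | p ∈ M ∧ ∀ θ, ρ θ p = p}

/-- The vector field `X` which generates the action. -/
def generator {N : ℕ} (ρ : Real.Angle → (Fin N → ℂ) → (Fin N → ℂ)) (p : Fin N → ℂ) :
    Fin N → ℂ :=
  deriv (fun t : ℝ => ρ (t : Real.Angle) p) 0

/-- `h` is a moment map of the action on `M`: a smooth function with `ω(X, ·) = -dh` on `TM`.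
(The derivative of `h` within `M` is determined on tangent vectors of `M`, and equals `dh`.) -/
structure IsMomentMap {N : ℕ} (M : Set (Fin N → ℂ))
    (ρ : Real.Angle → (Fin N → ℂ) → (Fin N → ℂ)) (h : (Fin N → ℂ) → ℝ) : Prop where
  smooth : ContDiffOn ℝ ∞ h M
  hamiltonian : ∀ p ∈ M, ∀ v ∈ tangentVectors M p,
    stdForm (generator ρ p) v = -(fderivWithin ℝ h M p v)

/-- The loop `t ↦ L t`, `0 ≤ t ≤ 2π`, of Lagrangian planes in `ℂ²` has Maslov index `m`:
with a continuous choice of unitary matrices `A t` whose columns are a real basis of `L t`,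
the map `(det A)²` from `[0, 2π]` to the unit circle has degree `m`, measured by a continuous
argument `φ`. The frame `A` itself need not close up. -/
def HasMaslovIndex (L : ℝ → Submodule ℝ (Fin 2 → ℂ)) (m : ℤ) : Prop :=
  ∃ (A : ℝ → Matrix (Fin 2) (Fin 2) ℂ) (φ : ℝ → ℝ),
    ContinuousOn A (Set.Icc 0 (2 * Real.pi)) ∧
    ContinuousOn φ (Set.Icc 0 (2 * Real.pi)) ∧
    (∀ t ∈ Set.Icc 0 (2 * Real.pi),
      A t ∈ Matrix.unitaryGroup (Fin 2) ℂ ∧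
      L t = Submodule.span ℝ (Set.range (A t).transpose) ∧
      (A t).det ^ 2 = Complex.exp (Complex.I * (φ t : ℂ))) ∧
    φ (2 * Real.pi) - φ 0 = 2 * Real.pi * (m : ℝ)

/-- `ψ : D → M` is a smooth map from the closed unit disc whose boundary is the (simply
traversed, oriented) orbit of `p`, where `T` is the minimal period of that orbit. -/
structure IsFillingDisc {N : ℕ} (M : Set (Fin N → ℂ))
    (ρ : Real.Angle → (Fin N → ℂ) → (Fin N → ℂ)) (p : Fin N → ℂ) (T : ℝ)
    (ψ : ℂ → (Fin N → ℂ)) : Prop where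
  smooth : ContDiffOn ℝ ∞ ψ (Metric.closedBall 0 1)
  mapsTo : ∀ s ∈ Metric.closedBall (0 : ℂ) 1, ψ s ∈ M
  boundary : ∀ t : ℝ, ψ (Complex.exp (Complex.I * (t : ℂ))) =
    ρ ((T * (t / (2 * Real.pi)) : ℝ) : Real.Angle) p

/-- `Φ` is a smooth symplectic trivialization of `ψ^*TM` over the closed unit disc; the fibre
`ℝ⁴ = ℂ²` carries the standard form. -/
structure IsSymplecticTrivialization {N : ℕ} (M : Set (Fin N → ℂ)) (ψ : ℂ → (Fin N → ℂ))
    (Φ : ℂ → ((Fin 2 → ℂ) →L[ℝ] (Fin N → ℂ))) : Prop where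
  smooth : ContDiffOn ℝ ∞ Φ (Metric.closedBall 0 1)
  range_eq : ∀ s ∈ Metric.closedBall (0 : ℂ) 1, Set.range (Φ s) = tangentVectors M (ψ s)
  symplectic : ∀ s ∈ Metric.closedBall (0 : ℂ) 1, ∀ a b, stdForm (Φ s a) (Φ s b) = stdForm a b

/-- The invariant plane field along the orbit of `p` obtained by transporting the plane
`X_p ∧ v` by the action, at the point with angle `θ`. -/
def orbitPlane {N : ℕ} (M : Set (Fin N → ℂ))
    (ρ : Real.Angle → (Fin N → ℂ) → (Fin N → ℂ)) (p v : Fin N → ℂ) (θ : Real.Angle) :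
    Submodule ℝ (Fin N → ℂ) :=
  Submodule.span ℝ
    {fderivWithin ℝ (ρ θ) M p (generator ρ p), fderivWithin ℝ (ρ θ) M p v}

/-- The Maslov condition at a point `p` which is not fixed. With `T` the minimal period of the
orbit of `p`, the orbit bounds a disc in `M`, over which `TM` has a symplectic trivialization,
and for every Lagrangian plane `X_p ∧ v ⊆ T_p M`, every such disc and every such
trivialization, the invariant plane field along the orbit has Maslov index zero. -/
def MaslovConditionAt {N : ℕ} (M : Set (Fin N → ℂ))
    (ρ : Real.Angle → (Fin N → ℂ) → (Fin N → ℂ)) (p : Fin N → ℂ) : Prop :=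
  ∃ T : ℝ, IsLeast {t : ℝ | 0 < t ∧ ρ (t : Real.Angle) p = p} T ∧
    (∃ ψ Φ, IsFillingDisc M ρ p T ψ ∧ IsSymplecticTrivialization M ψ Φ) ∧
    ∀ v ∈ tangentVectors M p, v ∉ Submodule.span ℝ {generator ρ p} →
      stdForm (generator ρ p) v = 0 →
      ∀ ψ Φ, IsFillingDisc M ρ p T ψ → IsSymplecticTrivialization M ψ Φ →
        HasMaslovIndex
          (fun t => (orbitPlane M ρ p v ((T * (t / (2 * Real.pi)) : ℝ) : Real.Angle)).comap
            (Φ (Complex.exp (Complex.I * (t : ℂ)))).toLinearMap) 0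

/-- `ρ` is a special Hamiltonian `S¹`-action on the symplectic 4-manifold `M ⊆ ℂ^N`, including
the standing assumptions that `M` is connected with `c₁(M, ω) = 0` and that the action is
effective with nonempty fixed point set. -/
structure IsSpecialHamiltonianAction {N : ℕ} (M : Set (Fin N → ℂ))
    (ρ : Real.Angle → (Fin N → ℂ) → (Fin N → ℂ)) : Prop where
  symplectic : IsSymplecticFourManifold M
  connected : IsConnected M
  chern : FirstChernClassVanishes M
  action : IsSmoothCircleAction M ρ
  effective : ∀ θ, (∀ p ∈ M, ρ θ p = p) → θ = 0
  fixed_nonempty : (fixedPoints M ρ).Nonempty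
  exists_momentMap : ∃ h, IsMomentMap M ρ h
  maslov : ∀ p ∈ M, p ∉ fixedPoints M ρ → MaslovConditionAt M ρ p

/-- The surface `W_n = {z₁² + z₂² + z₃^(n+1) = 1}` in `ℂ³`. -/
def W (n : ℕ) : Set (Fin 3 → ℂ) :=
  {z | z 0 ^ 2 + z 1 ^ 2 + z 2 ^ (n + 1) = 1}

/-- The circle action on `ℂ³` which rotates `(z₁, z₂)` and fixes `z₃`. -/
def rotation (θ : Real.Angle) (z : Fin 3 → ℂ) : Fin 3 → ℂ :=
  ![z 0 * (θ.cos : ℂ) - z 1 * (θ.sin : ℂ), z 0 * (θ.sin : ℂ) + z 1 * (θ.cos : ℂ), z 2]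

end SpecialHam

end

noncomputable section

namespace SpecialHam

open Filter Topology

/-! The polynomial z₀² + z₁² + z₂^(n+1) − 1 has no critical point on its zero set, so `W n` is a
complex hypersurface whose tangent space at p is the complex plane killed by `grad n p`.
Multiplication by i is therefore a compatible complex structure, and Ω(u, v) = det(conj (grad n p),
u, v), which is `volForm`, is a nowhere vanishing complex 2-form on the tangent planes; this gives
c₁ = 0. The rotation is real orthogonal of determinant one and `grad` is equivariant under it, so Ω
is invariant (`volForm_rotation`).

The Maslov condition follows from Ω. On a Lagrangian plane Ω does not vanish, and on the pair (X, v)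
transported along an orbit it is constant. If a trivialization Φ over a filling disc were complex
linear, Ω∘Φ would be a nonvanishing function on the disc times the determinant on ℂ²; that function
does not wind along the boundary, hence neither does the determinant of a unitary frame of the plane
field. A symplectic Φ splits as P + Q with P complex linear and Q antilinear, and
`volForm_interpolation_ne_zero` shows that Ω stays nonzero on unitary frames along the path P + τQ,
so the linear case suffices. `exists_log_of_homotopy` replaces winding numbers by periodic
logarithms, and `IsSymplecticFamily.hasMaslovIndex_zero` draws the conclusion.

Discs must also exist. With a = z₀ + iz₁ and b = z₀ − iz₁ the surface is ab = 1 − z₂^(n+1) and the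
action has weights 1, −1, 0; each free orbit then bounds an explicit disc through the fixed point
(0, 0, 1), over which there is an explicit orthogonal tangent frame (`exists_disc`). -/

/-! ### Tangent spaces of regular level sets. -/

/-- The derivative within `M` of a differentiable function agrees with the full derivative on
tangent vectors of `M`. -/
theorem fderivWithin_apply_of_mem_tangentVectors {N : ℕ} {F : Type*} [NormedAddCommGroup F]
    [NormedSpace ℝ F] {M : Set (Fin N → ℂ)} {p v : Fin N → ℂ} {f : (Fin N → ℂ) → F}
    (hf : DifferentiableAt ℝ f p) (hv : v ∈ tangentVectors M p) :
    fderivWithin ℝ f M p v = fderiv ℝ f p v := by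
  obtain ⟨γ, hγ, rfl, hd⟩ := hv
  have h1 := hf.differentiableWithinAt (s := M) |>.hasFDerivWithinAt.comp_hasDerivAt (0 : ℝ) hd
    (Eventually.of_forall hγ)
  exact h1.unique (hf.hasFDerivAt.comp_hasDerivAt (0 : ℝ) hd)

/-- Tangent vectors of a regular level set are exactly the kernel of the derivative. -/
theorem tangentVectors_eq_ker {N : ℕ} {F : Type*} [NormedAddCommGroup F] [NormedSpace ℝ F]
    [FiniteDimensional ℝ F] {M : Set (Fin N → ℂ)} {f : (Fin N → ℂ) → F}
    {f' : (Fin N → ℂ) →L[ℝ] F} {p : Fin N → ℂ} (hM : M = {z | f z = 0}) (hp : p ∈ M)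
    (hf : HasStrictFDerivAt f f' p) (hsurj : Function.Surjective f') :
    tangentVectors M p = {v | f' v = 0} := by
  subst hM
  have hp0 : f p = 0 := hp
  ext v
  constructor
  · rintro ⟨γ, hγ, h0, hd⟩
    have h1 := (h0 ▸ hf.hasFDerivAt).comp_hasDerivAt (0 : ℝ) hd
    have h2 : f ∘ γ = fun _ => 0 := funext hγ
    rw [h2] at h1
    exact h1.unique (hasDerivAt_const _ _)
  · intro hv
    have hr : f'.range = ⊤ := LinearMap.range_eq_top.2 hsurj
    set I := hf.implicitFunction f f' hr (f p) with hI
    have hI0 : I 0 = p := hf.implicitFunction_apply_image hr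
    have hId : HasStrictFDerivAt I f'.ker.subtypeL 0 := hf.to_implicitFunction hr
    let w : f'.ker := ⟨v, hv⟩
    have hw : HasDerivAt (fun t : ℝ => t • w) w 0 := by
      simpa using (hasDerivAt_id (0 : ℝ)).smul_const w
    have hw0 : (0 : ℝ) • w = 0 := zero_smul _ _
    have hcomp : HasDerivAt (fun t : ℝ => I (t • w)) v 0 :=
      HasFDerivAt.comp_hasDerivAt (0 : ℝ) (l := I) (l' := f'.ker.subtypeL) (hw0 ▸ hId.hasFDerivAt) hw
    have htend : Tendsto (fun t : ℝ => (f p, t • w)) (𝓝 0) (𝓝 (f p, 0)) := by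
      have : ContinuousAt (fun t : ℝ => (f p, t • w)) 0 := by fun_prop
      simpa [ContinuousAt] using this
    have hev : ∀ᶠ t : ℝ in 𝓝 0, f (I (t • w)) = 0 := by
      filter_upwards [htend.eventually (hf.map_implicitFunction_eq hr)] with t ht
      rw [hI, ht, hp0]
    classical
    -- A curve in `tangentVectors` must lie in `M` at all times, while the implicit function stays
    -- in `M` only for small t; elsewhere it is replaced by the constant p.
    refine ⟨fun t => if f (I (t • w)) = 0 then I (t • w) else p, fun t => ?_, ?_, ?_⟩
    · by_cases h : f (I (t • w)) = 0 <;> simp [h, hp0]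
    · simp [hI0, hp0]
    · refine hcomp.congr_of_eventuallyEq ?_
      filter_upwards [hev] with t ht
      simp [ht]

/-! ### `W n` as a regular level set of a complex polynomial. -/

/-- The gradient of the defining polynomial of `W n`. -/
def grad (n : ℕ) (p : Fin 3 → ℂ) : Fin 3 → ℂ :=
  ![2 * p 0, 2 * p 1, ((n : ℂ) + 1) * p 2 ^ n]

/-- The defining function of `W n`. -/
def defFun (n : ℕ) (z : Fin 3 → ℂ) : ℂ := z 0 ^ 2 + z 1 ^ 2 + z 2 ^ (n + 1) - 1

/-- The linear form with coefficients `g`. -/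
def linForm (g : Fin 3 → ℂ) : (Fin 3 → ℂ) →L[ℝ] ℂ :=
  (∑ i, g i • (ContinuousLinearMap.proj i : (Fin 3 → ℂ) →L[ℂ] ℂ)).restrictScalars ℝ

theorem linForm_apply (g v : Fin 3 → ℂ) :
    linForm g v = g 0 * v 0 + g 1 * v 1 + g 2 * v 2 := by
  simp [linForm, Fin.sum_univ_three]

theorem mem_W_iff {n : ℕ} {z : Fin 3 → ℂ} : z ∈ W n ↔ z 0 ^ 2 + z 1 ^ 2 + z 2 ^ (n + 1) = 1 :=
  Iff.rfl

theorem W_eq (n : ℕ) : W n = {z | defFun n z = 0} := by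
  ext z; simp [W, defFun, sub_eq_zero]

theorem hasStrictFDerivAt_defFun (n : ℕ) (p : Fin 3 → ℂ) :
    HasStrictFDerivAt (defFun n) (linForm (grad n p)) p := by
  have h (i : Fin 3) : HasStrictFDerivAt (fun z : Fin 3 → ℂ => z i)
      (ContinuousLinearMap.proj i : (Fin 3 → ℂ) →L[ℂ] ℂ) p :=
    (ContinuousLinearMap.proj i : (Fin 3 → ℂ) →L[ℂ] ℂ).hasStrictFDerivAt
  have := ((((h 0).pow 2).add ((h 1).pow 2)).add ((h 2).pow (n + 1))).sub_const 1
  refine (HasStrictFDerivAt.restrictScalars ℝ this).congr_fderiv ?_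
  ext v
  simp [linForm_apply, grad]

theorem linForm_surjective {g : Fin 3 → ℂ} (hg : g ≠ 0) : Function.Surjective (linForm g) := by
  obtain ⟨i, hi⟩ := Function.ne_iff.1 hg
  intro c
  refine ⟨Pi.single i (c / g i), ?_⟩
  have : g i ≠ 0 := hi
  simp [linForm, Pi.single_apply]
  field_simp

/-- At a critical point z₀, z₁ and z₂^n vanish, hence also z₂^(n+1) = z₂ · z₂^n, and the defining
equation would read 0 = 1. This also covers n = 0. -/
theorem grad_ne_zero {n : ℕ} {p : Fin 3 → ℂ} (hp : p ∈ W n) : grad n p ≠ 0 := by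
  intro h
  have h0 : p 0 = 0 := by simpa [grad] using congrFun h 0
  have h1 : p 1 = 0 := by simpa [grad] using congrFun h 1
  have hn : (n : ℂ) + 1 ≠ 0 := by exact_mod_cast Nat.succ_ne_zero n
  have h2 : p 2 ^ n = 0 := by
    have := congrFun h 2
    simpa only [grad, Matrix.cons_val, Pi.zero_apply, mul_eq_zero, hn, false_or] using this
  have := mem_W_iff.1 hp
  simp [h0, h1, pow_succ, h2] at this

theorem tangentVectors_W {n : ℕ} {p : Fin 3 → ℂ} (hp : p ∈ W n) :
    tangentVectors (W n) p = {v | linForm (grad n p) v = 0} :=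
  tangentVectors_eq_ker (W_eq n) hp (hasStrictFDerivAt_defFun n p)
    (linForm_surjective (grad_ne_zero hp))

theorem linForm_smul (g : Fin 3 → ℂ) (c : ℂ) (v : Fin 3 → ℂ) :
    linForm g (c • v) = c * linForm g v := by
  simp [linForm_apply]; ring

/-- This lets multiplication by i serve as the almost complex structure. -/
theorem smul_mem_tangentVectors_W {n : ℕ} {p v : Fin 3 → ℂ} (hp : p ∈ W n) (c : ℂ)
    (hv : v ∈ tangentVectors (W n) p) : c • v ∈ tangentVectors (W n) p := by
  rw [tangentVectors_W hp, Set.mem_ofPred_eq] at *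
  rw [linForm_smul, hv, mul_zero]

/-! ### Hermitian algebra and the symplectic structure. -/

/-- The Hermitian form of `ℂ^N`, conjugate linear in the first variable. -/
def herm {N : ℕ} (u v : Fin N → ℂ) : ℂ :=
  inner ℂ (WithLp.toLp 2 u : EuclideanSpace ℂ (Fin N)) (WithLp.toLp 2 v)

/-- The square of the Hermitian norm. -/
def nsq {N : ℕ} (u : Fin N → ℂ) : ℝ := ‖(WithLp.toLp 2 u : EuclideanSpace ℂ (Fin N))‖ ^ 2

section herm
variable {N : ℕ} (u v w : Fin N → ℂ) (c : ℂ)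

theorem herm_eq_sum : herm u v = ∑ j, (starRingEnd ℂ) (u j) * v j := by
  simp [herm, PiLp.inner_apply, mul_comm]

theorem herm_add_left : herm (u + v) w = herm u w + herm v w := by
  simp [herm]

theorem herm_add_right : herm u (v + w) = herm u v + herm u w := by
  simp [herm]

theorem herm_smul_left : herm (c • u) v = (starRingEnd ℂ) c * herm u v := by
  simp [herm, mul_comm]

theorem herm_smul_right : herm u (c • v) = c * herm u v := by
  simp [herm]

theorem herm_conj : (starRingEnd ℂ) (herm u v) = herm v u := by
  simp [herm]

theorem herm_self : herm u u = (nsq u : ℂ) := by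
  simp [herm, nsq, inner_self_eq_norm_sq_to_K]

theorem norm_herm_sq_le : ‖herm u v‖ ^ 2 ≤ nsq u * nsq v := by
  rw [nsq, nsq, ← mul_pow]
  exact pow_le_pow_left₀ (norm_nonneg _) (norm_inner_le_norm _ _) 2

theorem nsq_nonneg : 0 ≤ nsq u := sq_nonneg _

theorem nsq_smul : nsq (c • u) = ‖c‖ ^ 2 * nsq u := by
  simp [nsq, norm_smul, mul_pow]

variable {u}

theorem nsq_eq_zero_iff : nsq u = 0 ↔ u = 0 := by
  simp [nsq]

theorem nsq_pos (hu : u ≠ 0) : 0 < nsq u :=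
  (nsq_nonneg u).lt_of_ne fun h => hu (nsq_eq_zero_iff.1 h.symm)

variable (u)

theorem stdForm_eq_im : stdForm u v = (herm u v).im := by
  simp [stdForm, herm_eq_sum, Complex.im_sum, sub_eq_add_neg]

/-- Gives both nondegeneracy on complex subspaces and positivity of the metric defined by i. -/
theorem stdForm_smul_I : stdForm u (Complex.I • u) = nsq u := by
  simp [stdForm_eq_im, herm_smul_right, herm_self]

end herm

theorem isSmoothSubmanifold_W (n : ℕ) : IsSmoothSubmanifold 4 (W n) := by
  intro p hp
  let e : ℂ ≃L[ℝ] (Fin 2 → ℝ) := Complex.basisOneI.equivFunL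
  have hd (x) : HasStrictFDerivAt (fun x => e (defFun n x))
      ((e : ℂ →L[ℝ] (Fin 2 → ℝ)).comp (linForm (grad n x))) x :=
    HasStrictFDerivAt.comp x (e : ℂ →L[ℝ] (Fin 2 → ℝ)).hasStrictFDerivAt
      (hasStrictFDerivAt_defFun n x)
  have hgc : Continuous (grad n) := by unfold grad; fun_prop
  refine ⟨{x | grad n x ≠ 0}, 2, fun x => e (defFun n x), ?_, grad_ne_zero hp, rfl, ?_, ?_, ?_⟩
  · exact isOpen_ne_fun hgc continuous_const
  · refine ContDiff.contDiffOn (e.contDiff.comp ?_)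
    unfold defFun
    fun_prop
  · intro x _
    rw [W_eq]
    simp
  · intro x hx
    rw [(hd x).hasFDerivAt.fderiv]
    exact e.surjective.comp (linForm_surjective hx)

theorem isSymplecticFourManifold_W (n : ℕ) : IsSymplecticFourManifold (W n) where
  submanifold := isSmoothSubmanifold_W n
  nondegenerate p hp u hu hu0 :=
    ⟨Complex.I • u, smul_mem_tangentVectors_W hp _ hu, by
      rw [stdForm_smul_I]; exact (nsq_pos hu0).ne'⟩

/-! ### A nowhere vanishing complex 2-form, and c₁ = 0. -/

/-- The bilinear form `(u, v) ↦ u j * v k - u k * v j`. -/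
def minorForm (j k : Fin 3) : (Fin 3 → ℂ) →L[ℝ] (Fin 3 → ℂ) →L[ℝ] ℂ :=
  (ContinuousLinearMap.mul ℝ ℂ).bilinearComp (ContinuousLinearMap.proj j)
      (ContinuousLinearMap.proj k) -
    (ContinuousLinearMap.mul ℝ ℂ).bilinearComp (ContinuousLinearMap.proj k)
      (ContinuousLinearMap.proj j)

/-- The form `(u, v) ↦ det (conj g, u, v)`. -/
def volForm (g : Fin 3 → ℂ) : (Fin 3 → ℂ) →L[ℝ] (Fin 3 → ℂ) →L[ℝ] ℂ :=
  Complex.conjCLE (g 0) • minorForm 1 2 + Complex.conjCLE (g 1) • minorForm 2 0 +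
    Complex.conjCLE (g 2) • minorForm 0 1

theorem volForm_apply (g u v : Fin 3 → ℂ) : volForm g u v =
    (starRingEnd ℂ) (g 0) * (u 1 * v 2 - u 2 * v 1) +
    (starRingEnd ℂ) (g 1) * (u 2 * v 0 - u 0 * v 2) +
    (starRingEnd ℂ) (g 2) * (u 0 * v 1 - u 1 * v 0) := by
  simp [volForm, minorForm]

theorem volForm_eq_det (g u v : Fin 3 → ℂ) :
    volForm g u v = (Matrix.of ![star g, u, v]).det := by
  simp [volForm_apply, Matrix.det_fin_three]
  ring

/-- Vectors in the kernel of `g` on which the volume form vanishes are dependent over `ℂ`. -/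
theorem exists_dependence_of_volForm_eq_zero {g u v : Fin 3 → ℂ} (hg : g ≠ 0)
    (hu : linForm g u = 0) (hv : linForm g v = 0) (h : volForm g u v = 0) :
    ∃ x y : ℂ, (x ≠ 0 ∨ y ≠ 0) ∧ x • u + y • v = 0 := by
  rw [volForm_eq_det] at h
  obtain ⟨c, hc, hc0⟩ := Matrix.exists_vecMul_eq_zero_iff.2 h
  have hsum : c 0 • star g + c 1 • u + c 2 • v = 0 := by
    ext i
    have := congrFun hc0 i
    simpa [Matrix.vecMul, dotProduct, Fin.sum_univ_three] using this
  -- The form `linForm g` kills u and v and takes the value |g|² ≠ 0 on conj g, so it isolates the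
  -- coefficient of conj g.
  have h0 : c 0 = 0 := by
    have h1 : linForm g (c 0 • star g + c 1 • u + c 2 • v) = 0 := by rw [hsum, map_zero]
    rw [map_add, map_add, linForm_smul, linForm_smul, linForm_smul, hu, hv] at h1
    have h2 : linForm g (star g) = (nsq g : ℂ) := by
      rw [← herm_self, herm_eq_sum, linForm_apply, Fin.sum_univ_three]
      simp [mul_comm]
    have h3 : (nsq g : ℂ) ≠ 0 := by exact_mod_cast (nsq_pos hg).ne'
    rw [h2] at h1
    simpa [h3] using h1
  refine ⟨c 1, c 2, ?_, by simpa [h0] using hsum⟩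
  by_contra hcon
  push Not at hcon
  apply hc
  ext i
  fin_cases i <;> simp [h0, hcon.1, hcon.2]

theorem contDiff_volForm_grad (n : ℕ) : ContDiff ℝ ∞ fun p => volForm (grad n p) := by
  have h (i) : ContDiff ℝ ∞ fun p => grad n p i := by
    unfold grad
    fin_cases i <;> simp <;> fun_prop
  have h' (i) : ContDiff ℝ ∞ fun p => (starRingEnd ℂ) (grad n p i) :=
    Complex.conjCLE.contDiff.comp (h i)
  refine contDiff_clm_apply_iff.2 fun u => contDiff_clm_apply_iff.2 fun v => ?_
  simp only [volForm_apply]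
  exact (((h' 0).mul contDiff_const).add ((h' 1).mul contDiff_const)).add
    ((h' 2).mul contDiff_const)

/-- In the kernel of a nonzero `g` there are vectors on which the volume form does not vanish. -/
theorem exists_volForm_ne_zero {g : Fin 3 → ℂ} (hg : g ≠ 0) :
    ∃ u v, linForm g u = 0 ∧ linForm g v = 0 ∧ volForm g u v ≠ 0 := by
  obtain ⟨i, hi⟩ := Function.ne_iff.1 hg
  have h3 : (nsq g : ℂ) ≠ 0 := by exact_mod_cast (nsq_pos hg).ne'
  rw [← herm_self, herm_eq_sum, Fin.sum_univ_three] at h3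
  simp only [linForm_apply, volForm_apply]
  fin_cases i
  -- Where `g i` ≠ 0, the two obvious relations between `g i` and the other entries span the kernel;
  -- the form takes the value ± `g i` · |g|² on them.
  · refine ⟨![-g 1, g 0, 0], ![-g 2, 0, g 0], by simp; ring, by simp; ring, fun h => ?_⟩
    refine mul_ne_zero (show g 0 ≠ 0 from hi) h3 ?_
    rw [← h]; simp; ring
  · refine ⟨![g 1, -g 0, 0], ![0, -g 2, g 1], by simp; ring, by simp; ring, fun h => ?_⟩
    refine neg_ne_zero.2 (mul_ne_zero (show g 1 ≠ 0 from hi) h3) ?_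
    rw [← h]; simp; ring
  · refine ⟨![g 2, 0, -g 0], ![0, g 2, -g 1], by simp; ring, by simp; ring, fun h => ?_⟩
    refine mul_ne_zero (show g 2 ≠ 0 from hi) h3 ?_
    rw [← h]; simp; ring

theorem firstChernClassVanishes_W (n : ℕ) : FirstChernClassVanishes (W n) := by
  refine ⟨fun _ => (Complex.I • ContinuousLinearMap.id ℝ (Fin 3 → ℂ)), fun p => volForm (grad n p),
    contDiffOn_const, (contDiff_volForm_grad n).contDiffOn, fun p hp => ⟨?_, ?_, ?_, ?_, ?_, ?_⟩⟩
  · intro v hv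
    refine ⟨smul_mem_tangentVectors_W hp _ hv, ?_⟩
    simp [smul_smul]
  · intro u _ v _
    simp [stdForm_eq_im, herm_smul_left, herm_smul_right, ← mul_assoc]
  · intro v _ hv
    have := nsq_pos hv
    simpa [stdForm_smul_I] using this
  · intro v _
    simp [volForm_apply]; ring
  · intro u _ v _
    simp [volForm_apply]; ring
  · obtain ⟨u, v, hu, hv, h⟩ := exists_volForm_ne_zero (grad_ne_zero hp)
    rw [tangentVectors_W hp]
    exact ⟨u, hu, v, hv, h⟩

/-! ### Coordinates diagonalizing the rotation, and connectedness. -/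

/-- The point of `ℂ³` with `z₀ + i z₁ = a`, `z₀ - i z₁ = b`, `z₂ = w`. -/
def ofLight (a b w : ℂ) : Fin 3 → ℂ := ![(a + b) / 2, -Complex.I * (a - b) / 2, w]

theorem ofLight_mem_W {n : ℕ} {a b w : ℂ} : ofLight a b w ∈ W n ↔ a * b = 1 - w ^ (n + 1) := by
  have : ((a + b) / 2) ^ 2 + (-Complex.I * (a - b) / 2) ^ 2 = a * b := by
    linear_combination (a - b) ^ 2 / 4 * Complex.I_sq
  rw [mem_W_iff]
  simp only [ofLight, Matrix.cons_val]
  rw [this, eq_sub_iff_add_eq]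

theorem eq_ofLight (z : Fin 3 → ℂ) :
    z = ofLight (z 0 + Complex.I * z 1) (z 0 - Complex.I * z 1) (z 2) := by
  ext i
  fin_cases i
  · simp [ofLight]
  · simp [ofLight]
    linear_combination z 1 * Complex.I_sq
  · simp [ofLight]

theorem continuous_ofLight : Continuous fun x : ℂ × ℂ × ℂ => ofLight x.1 x.2.1 x.2.2 := by
  unfold ofLight; fun_prop

theorem isConnected_punctured_prod : IsConnected ({(0 : ℂ)}ᶜ ×ˢ (Set.univ : Set ℂ)) :=
  (isConnected_compl_singleton_of_one_lt_rank (by simp) 0).prod isConnected_univ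

theorem continuousOn_one_sub_pow_div (n : ℕ) :
    ContinuousOn (fun x : ℂ × ℂ => (1 - x.2 ^ (n + 1)) / x.1)
      ({(0 : ℂ)}ᶜ ×ˢ (Set.univ : Set ℂ)) :=
  ContinuousOn.div (by fun_prop) (by fun_prop) fun x hx => hx.1

/-- The chart of the part of `W n` where `z₀ + i z₁ ≠ 0`. -/
def leftChart (n : ℕ) (x : ℂ × ℂ) : Fin 3 → ℂ := ofLight x.1 ((1 - x.2 ^ (n + 1)) / x.1) x.2

/-- The chart of the part of `W n` where `z₀ - i z₁ ≠ 0`. -/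
def rightChart (n : ℕ) (x : ℂ × ℂ) : Fin 3 → ℂ := ofLight ((1 - x.2 ^ (n + 1)) / x.1) x.1 x.2

/-- Each chart image is a continuous image of ℂ* × ℂ, and both contain the point a = b = 1, w = 0.
-/
theorem isConnected_charts (n : ℕ) :
    IsConnected (leftChart n '' ({(0 : ℂ)}ᶜ ×ˢ (Set.univ : Set ℂ)) ∪
      rightChart n '' ({(0 : ℂ)}ᶜ ×ˢ (Set.univ : Set ℂ))) := by
  have hl : leftChart n (1, 0) = ofLight 1 1 0 := by simp [leftChart]
  have hr : rightChart n (1, 0) = ofLight 1 1 0 := by simp [rightChart]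
  have hm : ((1 : ℂ), (0 : ℂ)) ∈ ({(0 : ℂ)}ᶜ ×ˢ (Set.univ : Set ℂ)) := by simp
  refine IsConnected.union (Set.nonempty_of_mem (x := ofLight 1 1 0)
    (Set.mem_inter (hl ▸ Set.mem_image_of_mem _ hm) (hr ▸ Set.mem_image_of_mem _ hm))) ?_ ?_
  · refine isConnected_punctured_prod.image _ ?_
    have h : leftChart n = (fun x : ℂ × ℂ × ℂ => ofLight x.1 x.2.1 x.2.2) ∘
        fun x : ℂ × ℂ => (x.1, (1 - x.2 ^ (n + 1)) / x.1, x.2) := rfl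
    rw [h]
    exact continuous_ofLight.comp_continuousOn
      (continuousOn_fst.prodMk ((continuousOn_one_sub_pow_div n).prodMk continuousOn_snd))
  · refine isConnected_punctured_prod.image _ ?_
    have h : rightChart n = (fun x : ℂ × ℂ × ℂ => ofLight x.1 x.2.1 x.2.2) ∘
        fun x : ℂ × ℂ => ((1 - x.2 ^ (n + 1)) / x.1, x.1, x.2) := rfl
    rw [h]
    exact continuous_ofLight.comp_continuousOn
      ((continuousOn_one_sub_pow_div n).prodMk (continuousOn_fst.prodMk continuousOn_snd))

/-- The charts miss only the points with a = b = 0. Such a point is the limit of (t, 0, w), which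
stays on the surface because 1 − w^(n+1) = 0. -/
theorem ofLight_mem_closure_charts {n : ℕ} {a b w : ℂ} (h : a * b = 1 - w ^ (n + 1)) :
    ofLight a b w ∈ closure (leftChart n '' ({(0 : ℂ)}ᶜ ×ˢ (Set.univ : Set ℂ)) ∪
      rightChart n '' ({(0 : ℂ)}ᶜ ×ˢ (Set.univ : Set ℂ))) := by
  by_cases ha : a = 0
  · by_cases hb0 : b = 0
    · subst ha hb0
      have hw : 1 - w ^ (n + 1) = 0 := by simpa using h.symm
      have ht : Tendsto (fun t : ℂ => ofLight t 0 w) (𝓝[≠] 0) (𝓝 (ofLight 0 0 w)) := by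
        have : Continuous fun t : ℂ => ofLight t 0 w :=
          continuous_ofLight.comp (by fun_prop : Continuous fun t : ℂ => (t, (0 : ℂ), w))
        exact (this.tendsto 0).mono_left nhdsWithin_le_nhds
      refine mem_closure_of_tendsto ht ?_
      filter_upwards [self_mem_nhdsWithin] with t ht
      exact Or.inl ⟨(t, w), ⟨ht, trivial⟩, by simp [leftChart, hw]⟩
    · refine subset_closure (Or.inr ⟨(b, w), ⟨hb0, trivial⟩, ?_⟩)
      simp only [rightChart, ← h]
      rw [mul_div_cancel_right₀ _ hb0]
  · refine subset_closure (Or.inl ⟨(a, w), ⟨ha, trivial⟩, ?_⟩)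
    simp only [leftChart, ← h]
    rw [mul_div_cancel_left₀ _ ha]

theorem isConnected_W (n : ℕ) : IsConnected (W n) := by
  refine (isConnected_charts n).subset_closure ?_ fun z hz => ?_
  · rintro _ (⟨x, hx, rfl⟩ | ⟨x, hx, rfl⟩)
    · exact ofLight_mem_W.2 (mul_div_cancel₀ _ hx.1)
    · exact ofLight_mem_W.2 (div_mul_cancel₀ _ hx.1)
  · rw [eq_ofLight z] at hz ⊢
    exact ofLight_mem_closure_charts (ofLight_mem_W.1 hz)

/-! ### The circle action: freeness, generator, moment map, fixed points. -/

/-- The rotation as a complex linear map. -/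
def rotationCLM (θ : Real.Angle) : (Fin 3 → ℂ) →L[ℂ] (Fin 3 → ℂ) :=
  LinearMap.toContinuousLinearMap
    { toFun := rotation θ
      map_add' := fun u v => by
        ext i; fin_cases i <;> simp [rotation] <;> ring
      map_smul' := fun c u => by
        ext i; fin_cases i <;> simp [rotation] <;> ring }

theorem hasFDerivAt_rotation (θ : Real.Angle) (p : Fin 3 → ℂ) :
    HasFDerivAt (rotation θ) ((rotationCLM θ).restrictScalars ℝ) p :=
  ((rotationCLM θ).restrictScalars ℝ).hasFDerivAt

theorem sq_add_sq_cos_sin (θ : Real.Angle) : (θ.cos : ℂ) ^ 2 + (θ.sin : ℂ) ^ 2 = 1 := by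
  exact_mod_cast θ.cos_sq_add_sin_sq

theorem rotation_zero (p : Fin 3 → ℂ) : rotation 0 p = p := by
  ext i; fin_cases i <;> simp [rotation]

theorem rotation_add (θ θ' : Real.Angle) (p : Fin 3 → ℂ) :
    rotation (θ + θ') p = rotation θ (rotation θ' p) := by
  ext i; fin_cases i <;> simp [rotation, Real.Angle.cos_add, Real.Angle.sin_add] <;> ring

theorem rotation_mem_W {n : ℕ} (θ : Real.Angle) {p : Fin 3 → ℂ} (hp : p ∈ W n) :
    rotation θ p ∈ W n := by
  rw [mem_W_iff] at *
  simp only [rotation, Matrix.cons_val]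
  linear_combination hp + (p 0 ^ 2 + p 1 ^ 2) * sq_add_sq_cos_sin θ

theorem rotation_image_W (n : ℕ) (θ : Real.Angle) : rotation θ '' W n = W n := by
  refine Set.Subset.antisymm (Set.image_subset_iff.2 fun p hp => rotation_mem_W θ hp) fun p hp => ?_
  exact ⟨rotation (-θ) p, rotation_mem_W _ hp, by rw [← rotation_add, add_neg_cancel, rotation_zero]⟩

theorem contDiff_rotation :
    ContDiff ℝ ∞ fun x : ℝ × (Fin 3 → ℂ) => rotation (x.1 : Real.Angle) x.2 := by
  have hc : ContDiff ℝ ∞ fun x : ℝ × (Fin 3 → ℂ) => ((Real.cos x.1 : ℝ) : ℂ) :=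
    Complex.ofRealCLM.contDiff.comp (Real.contDiff_cos.comp contDiff_fst)
  have hs : ContDiff ℝ ∞ fun x : ℝ × (Fin 3 → ℂ) => ((Real.sin x.1 : ℝ) : ℂ) :=
    Complex.ofRealCLM.contDiff.comp (Real.contDiff_sin.comp contDiff_fst)
  have hp (i : Fin 3) : ContDiff ℝ ∞ fun x : ℝ × (Fin 3 → ℂ) => x.2 i := by fun_prop
  rw [contDiff_pi]
  intro i
  fin_cases i
  · simpa [rotation] using ((hp 0).mul hc).sub ((hp 1).mul hs)
  · simpa [rotation] using ((hp 0).mul hs).add ((hp 1).mul hc)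
  · simpa [rotation] using hp 2

theorem isSmoothCircleAction_rotation {M : Set (Fin 3 → ℂ)}
    (hM : ∀ θ, ∀ p ∈ M, rotation θ p ∈ M) : IsSmoothCircleAction M rotation where
  mapsTo := hM
  zero_act p _ := rotation_zero p
  add_act θ θ' p _ := rotation_add θ θ' p
  smooth := contDiff_rotation.contDiffOn

theorem rotation_eq_self_iff {θ : Real.Angle} {p : Fin 3 → ℂ} :
    rotation θ p = p ↔ θ = 0 ∨ (p 0 = 0 ∧ p 1 = 0) := by
  constructor
  · intro h
    have h0 := congrFun h 0
    have h1 := congrFun h 1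
    simp only [rotation, Matrix.cons_val] at h0 h1
    -- With R the planar rotation, (R − 1)ᵀ(R − 1) = 2 − 2 cos θ; the two combinations are the rows
    -- of (R − 1)ᵀ applied to (R − 1)p = 0.
    have key0 : p 0 * (2 - 2 * (θ.cos : ℂ)) = 0 := by
      linear_combination ((θ.cos : ℂ) - 1) * h0 + (θ.sin : ℂ) * h1 - p 0 * sq_add_sq_cos_sin θ
    have key1 : p 1 * (2 - 2 * (θ.cos : ℂ)) = 0 := by
      linear_combination -(θ.sin : ℂ) * h0 + ((θ.cos : ℂ) - 1) * h1 - p 1 * sq_add_sq_cos_sin θ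
    by_cases hc : 2 - 2 * (θ.cos : ℂ) = 0
    · left
      have hc1 : θ.cos = 1 := by
        have : (θ.cos : ℂ) = 1 := by linear_combination -hc / 2
        exact_mod_cast this
      have hs : θ.sin = 0 := by
        have := θ.cos_sq_add_sin_sq
        rw [hc1] at this
        exact pow_eq_zero_iff two_ne_zero |>.1 (by linarith)
      induction θ using Real.Angle.induction_on with
      | _ x => exact Real.Angle.cos_sin_inj (by simpa using hc1) (by simpa using hs)
    · right
      exact ⟨(mul_eq_zero.1 key0).resolve_right hc, (mul_eq_zero.1 key1).resolve_right hc⟩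
  · rintro (rfl | ⟨h0, h1⟩)
    · exact rotation_zero p
    · ext i; fin_cases i <;> simp [rotation, h0, h1]

theorem rotation_fixes_iff {p : Fin 3 → ℂ} :
    (∀ θ, rotation θ p = p) ↔ p 0 = 0 ∧ p 1 = 0 := by
  constructor
  · intro h
    refine (rotation_eq_self_iff.1 (h (Real.pi : ℝ))).resolve_left ?_
    exact Real.Angle.pi_ne_zero
  · exact fun h θ => rotation_eq_self_iff.2 (Or.inr h)

theorem generator_rotation (p : Fin 3 → ℂ) : generator rotation p = ![-p 1, p 0, 0] := by
  unfold generator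
  apply HasDerivAt.deriv
  have hc : HasDerivAt (fun t : ℝ => ((Real.cos t : ℝ) : ℂ)) 0 0 := by
    simpa using (Real.hasDerivAt_cos 0).ofReal_comp
  have hs : HasDerivAt (fun t : ℝ => ((Real.sin t : ℝ) : ℂ)) 1 0 := by
    simpa using (Real.hasDerivAt_sin 0).ofReal_comp
  rw [hasDerivAt_pi]
  intro i
  fin_cases i
  · simpa [rotation] using (hc.const_mul (p 0)).fun_sub (hs.const_mul (p 1))
  · simpa [rotation] using (hs.const_mul (p 0)).fun_add (hc.const_mul (p 1))
  · simpa [rotation] using hasDerivAt_const (0 : ℝ) (p 2)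

theorem generator_mem_tangentVectors {n : ℕ} {p : Fin 3 → ℂ} (hp : p ∈ W n) :
    generator rotation p ∈ tangentVectors (W n) p := by
  rw [tangentVectors_W hp, generator_rotation]
  simp [linForm_apply, grad]
  ring

/-- The Hamiltonian is Im(z₀ · conj z₁). It works on all of ℂ³, hence on any subset. -/
theorem isMomentMap_rotation {M : Set (Fin 3 → ℂ)} :
    IsMomentMap M rotation fun z => (z 0).im * (z 1).re - (z 0).re * (z 1).im := by
  have hre (i : Fin 3) (p : Fin 3 → ℂ) : HasFDerivAt (fun z : Fin 3 → ℂ => (z i).re)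
      (Complex.reCLM.comp (ContinuousLinearMap.proj i)) p :=
    (Complex.reCLM.comp (ContinuousLinearMap.proj i : (Fin 3 → ℂ) →L[ℝ] ℂ)).hasFDerivAt
  have him (i : Fin 3) (p : Fin 3 → ℂ) : HasFDerivAt (fun z : Fin 3 → ℂ => (z i).im)
      (Complex.imCLM.comp (ContinuousLinearMap.proj i)) p :=
    (Complex.imCLM.comp (ContinuousLinearMap.proj i : (Fin 3 → ℂ) →L[ℝ] ℂ)).hasFDerivAt
  have hre' (i : Fin 3) : ContDiff ℝ ∞ fun z : Fin 3 → ℂ => (z i).re :=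
    (Complex.reCLM.comp (ContinuousLinearMap.proj i : (Fin 3 → ℂ) →L[ℝ] ℂ)).contDiff
  have him' (i : Fin 3) : ContDiff ℝ ∞ fun z : Fin 3 → ℂ => (z i).im :=
    (Complex.imCLM.comp (ContinuousLinearMap.proj i : (Fin 3 → ℂ) →L[ℝ] ℂ)).contDiff
  refine ⟨(((him' 0).mul (hre' 1)).sub ((hre' 0).mul (him' 1))).contDiffOn, fun p hp v hv => ?_⟩
  have hd := ((him 0 p).mul (hre 1 p)).sub ((hre 0 p).mul (him 1 p))
  have h := fderivWithin_apply_of_mem_tangentVectors hd.differentiableAt hv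
  rw [hd.fderiv] at h
  refine Eq.trans ?_ (congrArg Neg.neg h).symm
  rw [generator_rotation]
  simp [stdForm, Fin.sum_univ_three]
  ring

theorem fixedPoints_W (n : ℕ) : fixedPoints (W n) rotation =
    {p | ∃ k : ℕ, k ≤ n ∧
      p = ![0, 0, Complex.exp (2 * (Real.pi : ℂ) * Complex.I / ((n : ℂ) + 1)) ^ k]} := by
  have hprim := Complex.isPrimitiveRoot_exp (n + 1) n.succ_ne_zero
  push_cast at hprim
  ext p
  simp only [fixedPoints, Set.mem_ofPred_eq, rotation_fixes_iff]
  constructor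
  · rintro ⟨hp, h0, h1⟩
    rw [mem_W_iff, h0, h1] at hp
    obtain ⟨k, hk, hk'⟩ := hprim.eq_pow_of_pow_eq_one (by simpa using hp)
    refine ⟨k, by lia, ?_⟩
    rw [hk']
    ext i; fin_cases i <;> simp [h0, h1]
  · rintro ⟨k, -, rfl⟩
    refine ⟨?_, rfl, rfl⟩
    rw [mem_W_iff]
    simp only [Matrix.cons_val]
    rw [← pow_mul, mul_comm k, pow_mul, hprim.pow_eq_one]
    simp

theorem ncard_fixedPoints_W (n : ℕ) : (fixedPoints (W n) rotation).ncard = n + 1 := by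
  have hprim := Complex.isPrimitiveRoot_exp (n + 1) n.succ_ne_zero
  push_cast at hprim
  have : fixedPoints (W n) rotation =
      (fun k : ℕ => ![0, 0, Complex.exp (2 * (Real.pi : ℂ) * Complex.I / ((n : ℂ) + 1)) ^ k]) ''
        (Finset.range (n + 1) : Set ℕ) := by
    rw [fixedPoints_W]
    ext p
    simp only [Set.mem_ofPred_eq, Set.mem_image, Finset.coe_range, Set.mem_Iio, Nat.lt_succ_iff,
      eq_comm]
  rw [this, Set.InjOn.ncard_image, Set.ncard_coe_finset, Finset.card_range]
  intro i hi j hj hij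
  simp only [Finset.coe_range, Set.mem_Iio] at hi hj
  exact hprim.pow_inj hi hj (by simpa using congrFun hij 2)

theorem effective_rotation_W {n : ℕ} {θ : Real.Angle} (h : ∀ p ∈ W n, rotation θ p = p) :
    θ = 0 := by
  refine (rotation_eq_self_iff.1 (h ![1, 0, 0] ?_)).resolve_right (by simp)
  simp [mem_W_iff]

/-! ### Filling discs and symplectic trivializations. -/

/-- The complex linear map with columns `u` and `v`. -/
def frameMap (u v : Fin 3 → ℂ) : (Fin 2 → ℂ) →L[ℝ] (Fin 3 → ℂ) :=
  (((ContinuousLinearMap.proj 0 : (Fin 2 → ℂ) →L[ℂ] ℂ).smulRight u +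
    (ContinuousLinearMap.proj 1 : (Fin 2 → ℂ) →L[ℂ] ℂ).smulRight v)).restrictScalars ℝ

theorem frameMap_apply (u v : Fin 3 → ℂ) (c : Fin 2 → ℂ) :
    frameMap u v c = c 0 • u + c 1 • v := by
  simp [frameMap]

theorem herm_frameMap {u v : Fin 3 → ℂ} (hu : nsq u = 1) (hv : nsq v = 1) (huv : herm u v = 0)
    (a b : Fin 2 → ℂ) : herm (frameMap u v a) (frameMap u v b) = herm a b := by
  have hvu : herm v u = 0 := by rw [← herm_conj, huv, map_zero]
  simp only [frameMap_apply, herm_add_left, herm_add_right, herm_smul_left, herm_smul_right,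
    huv, hvu, herm_self, hu, hv]
  simp [herm_eq_sum, Fin.sum_univ_two, mul_comm]

/-- A unitary frame map preserves the Hermitian form and so is injective; its range lies in the
kernel, and both have real dimension 4 = 6 − 2. -/
theorem range_frameMap {u v g : Fin 3 → ℂ} (hu : nsq u = 1) (hv : nsq v = 1) (huv : herm u v = 0)
    (hg : g ≠ 0) (hgu : linForm g u = 0) (hgv : linForm g v = 0) :
    Set.range (frameMap u v) = {w | linForm g w = 0} := by
  have hinj : Function.Injective (frameMap u v) := by
    rw [injective_iff_map_eq_zero]
    intro a ha
    have := herm_frameMap hu hv huv a a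
    rw [ha, herm_self, herm_self] at this
    rw [← nsq_eq_zero_iff]
    have h0 : nsq (0 : Fin 3 → ℂ) = 0 := nsq_eq_zero_iff.2 rfl
    rw [h0] at this
    exact_mod_cast this.symm
  have hle : LinearMap.range (frameMap u v).toLinearMap ≤ LinearMap.ker (linForm g).toLinearMap := by
    rintro _ ⟨a, rfl⟩
    simp [frameMap_apply, linForm_smul, hgu, hgv]
  have h1 : Module.finrank ℝ (LinearMap.range (frameMap u v).toLinearMap) = 4 := by
    rw [LinearMap.finrank_range_of_inj hinj]
    simp [Module.finrank_pi_fintype]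
  have h2 : Module.finrank ℝ (LinearMap.ker (linForm g).toLinearMap) = 4 := by
    have := LinearMap.finrank_range_add_finrank_ker (linForm g).toLinearMap
    rw [LinearMap.range_eq_top.2 (linForm_surjective hg), finrank_top] at this
    simp [Module.finrank_pi_fintype] at this
    lia
  have := Submodule.eq_of_le_of_finrank_eq hle (h1.trans h2.symm)
  simpa [SetLike.ext'_iff, Set.ext_iff] using this

theorem contDiffOn_nsq {D : Set ℂ} {e : ℂ → Fin 3 → ℂ} (he : ContDiffOn ℝ ∞ e D) :
    ContDiffOn ℝ ∞ (fun s => nsq (e s)) D := by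
  have : ContDiff ℝ ∞ fun u : Fin 3 → ℂ => nsq u := by
    have hL : ContDiff ℝ ∞ fun u : Fin 3 → ℂ => (WithLp.toLp 2 u : EuclideanSpace ℂ (Fin 3)) :=
      PiLp.contDiff_toLp
    exact hL.norm_sq ℝ
  exact this.comp_contDiffOn he

/-- An orthogonal frame of `ψ^*TM` gives a symplectic trivialization. -/
theorem exists_trivialization_of_orthogonal_frame {M : Set (Fin 3 → ℂ)} {ψ G e f : ℂ → Fin 3 → ℂ}
    (hT : ∀ s ∈ Metric.closedBall (0 : ℂ) 1,
      G s ≠ 0 ∧ tangentVectors M (ψ s) = {v | linForm (G s) v = 0})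
    (he : ContDiffOn ℝ ∞ e (Metric.closedBall 0 1)) (hf : ContDiffOn ℝ ∞ f (Metric.closedBall 0 1))
    (he0 : ∀ s ∈ Metric.closedBall (0 : ℂ) 1, e s ≠ 0)
    (hf0 : ∀ s ∈ Metric.closedBall (0 : ℂ) 1, f s ≠ 0)
    (hef : ∀ s ∈ Metric.closedBall (0 : ℂ) 1, herm (e s) (f s) = 0)
    (heT : ∀ s ∈ Metric.closedBall (0 : ℂ) 1, linForm (G s) (e s) = 0)
    (hfT : ∀ s ∈ Metric.closedBall (0 : ℂ) 1, linForm (G s) (f s) = 0) :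
    ∃ Φ, IsSymplecticTrivialization M ψ Φ := by
  have hN (u : Fin 3 → ℂ) (hu : u ≠ 0) : nsq ((((√(nsq u))⁻¹ : ℝ) : ℂ) • u) = 1 := by
    rw [nsq_smul, Complex.norm_real, Real.norm_eq_abs, sq_abs, inv_pow, Real.sq_sqrt (nsq_nonneg u)]
    exact inv_mul_cancel₀ (nsq_pos hu).ne'
  have hC (e : ℂ → Fin 3 → ℂ) (he : ContDiffOn ℝ ∞ e (Metric.closedBall 0 1))
      (he0 : ∀ s ∈ Metric.closedBall (0 : ℂ) 1, e s ≠ 0) :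
      ContDiffOn ℝ ∞ (fun s => (((√(nsq (e s)))⁻¹ : ℝ) : ℂ) • e s) (Metric.closedBall 0 1) := by
    have h1 : ContDiffOn ℝ ∞ (fun s => (√(nsq (e s)))⁻¹) (Metric.closedBall 0 1) :=
      ((contDiffOn_nsq he).sqrt fun s hs => (nsq_pos (he0 s hs)).ne').inv
        fun s hs => (Real.sqrt_pos.2 (nsq_pos (he0 s hs))).ne'
    exact (h1.smul he).congr fun s _ => by
      ext i; simp
  refine ⟨fun s => frameMap ((((√(nsq (e s)))⁻¹ : ℝ) : ℂ) • e s)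
    ((((√(nsq (f s)))⁻¹ : ℝ) : ℂ) • f s), ?_, ?_, ?_⟩
  · refine contDiffOn_clm_apply.2 fun c => ?_
    simp only [frameMap_apply]
    exact ((hC e he he0).const_smul _).add ((hC f hf hf0).const_smul _)
  · intro s hs
    rw [(hT s hs).2]
    refine range_frameMap (hN _ (he0 s hs)) (hN _ (hf0 s hs)) ?_ (hT s hs).1 ?_ ?_
    · rw [herm_smul_left, herm_smul_right, hef s hs, mul_zero, mul_zero]
    · rw [linForm_smul, heT s hs, mul_zero]
    · rw [linForm_smul, hfT s hs, mul_zero]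
  · intro s hs a b
    rw [stdForm_eq_im, stdForm_eq_im, herm_frameMap (hN _ (he0 s hs)) (hN _ (hf0 s hs))]
    rw [herm_smul_left, herm_smul_right, hef s hs, mul_zero, mul_zero]

/-- In these coordinates the defining function is ab + w^(n+1) − 1, and this is its differential. -/
theorem linForm_grad_ofLight (n : ℕ) (A B w α β v : ℂ) :
    linForm (grad n (ofLight A B w)) (ofLight α β v) =
      A * β + B * α + ((n : ℂ) + 1) * w ^ n * v := by
  simp [linForm_apply, grad, ofLight]
  linear_combination (A - B) * (α - β) / 2 * Complex.I_sq

theorem herm_ofLight (a b w a' b' w' : ℂ) : herm (ofLight a b w) (ofLight a' b' w') =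
    ((starRingEnd ℂ) a * a' + (starRingEnd ℂ) b * b') / 2 + (starRingEnd ℂ) w * w' := by
  have h2 : (starRingEnd ℂ) (2 : ℂ) = 2 := map_ofNat _ 2
  simp [herm_eq_sum, Fin.sum_univ_three, ofLight, h2]
  linear_combination -((starRingEnd ℂ) a - (starRingEnd ℂ) b) * (a' - b') / 4 * Complex.I_sq

theorem ofLight_eq_zero_iff {a b w : ℂ} : ofLight a b w = 0 ↔ a = 0 ∧ b = 0 ∧ w = 0 := by
  constructor
  · intro h
    have h0 := congrFun h 0
    have h1 := congrFun h 1
    have h2 := congrFun h 2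
    simp [ofLight] at h0 h1 h2
    have : a = b := sub_eq_zero.1 h1
    subst this
    refine ⟨?_, ?_, h2⟩ <;> linear_combination h0 / 2
  · rintro ⟨rfl, rfl, rfl⟩
    ext i; fin_cases i <;> simp [ofLight]

theorem contDiff_ofLight : ContDiff ℝ ∞ fun x : ℂ × ℂ × ℂ => ofLight x.1 x.2.1 x.2.2 := by
  rw [contDiff_pi]
  intro i
  fin_cases i <;> simp [ofLight] <;> fun_prop

theorem contDiff_conj : ContDiff ℝ ∞ fun s : ℂ => (starRingEnd ℂ) s := Complex.conjCLE.contDiff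

theorem rotation_ofLight (t : ℝ) (a b w : ℂ) : rotation (t : Real.Angle) (ofLight a b w) =
    ofLight (Complex.exp (Complex.I * t) * a)
      ((starRingEnd ℂ) (Complex.exp (Complex.I * t)) * b) w := by
  have h : Complex.exp (Complex.I * t) = Complex.cos t + Complex.sin t * Complex.I := by
    rw [mul_comm, Complex.exp_mul_I]
  have h' : (starRingEnd ℂ) (Complex.exp (Complex.I * t)) =
      Complex.cos t - Complex.sin t * Complex.I := by
    rw [← Complex.exp_conj]
    simp [Complex.exp_mul_I, mul_comm Complex.I, ← neg_mul, sub_eq_add_neg]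
  rw [h', h]
  ext i
  fin_cases i
  · simp [rotation, ofLight]; ring
  · simp [rotation, ofLight]
    linear_combination (a + b) * Complex.sin t / 2 * Complex.I_sq
  · simp [rotation, ofLight]

/-- The orbit of a point with `z₀ + i z₁ ≠ 0` bounds a disc in `W n` which passes through the fixed
point `(0, 0, 1)` and over which the tangent bundle has an explicit unitary frame. -/
theorem exists_disc_of_left_ne_zero {n : ℕ} {p : Fin 3 → ℂ} (hp : p ∈ W n)
    (ha : p 0 + Complex.I * p 1 ≠ 0) :
    ∃ ψ Φ, IsFillingDisc (W n) rotation p (2 * Real.pi) ψ ∧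
      IsSymplecticTrivialization (W n) ψ Φ := by
  rw [eq_ofLight p] at hp ⊢
  generalize p 0 + Complex.I * p 1 = a at *
  generalize p 0 - Complex.I * p 1 = b at *
  generalize p 2 = w at *
  rw [ofLight_mem_W] at hp
  -- The third coordinate moves on the segment from 1 at the centre to w at the boundary, with
  -- parameter |s|². Since A = s·a, the equation forces B = (1 − ζ^(n+1)) / (s·a); the geometric sum
  -- cancels the factor s, which makes B smooth at 0.
  let ζ : ℂ → ℂ := fun s => 1 + s * (starRingEnd ℂ) s * (w - 1)
  let A : ℂ → ℂ := fun s => s * a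
  let B : ℂ → ℂ := fun s =>
    (starRingEnd ℂ) s * (-(w - 1) * ∑ i ∈ Finset.range (n + 1), ζ s ^ i) / a
  let R : ℂ → ℂ := fun s => ((n : ℂ) + 1) * ζ s ^ n
  have hζ : ContDiff ℝ ∞ ζ := by
    have := contDiff_conj
    fun_prop
  have hA : ContDiff ℝ ∞ A := by fun_prop
  have hB : ContDiff ℝ ∞ B := by
    have := contDiff_conj
    fun_prop
  have hR : ContDiff ℝ ∞ R := by fun_prop
  have hAc : ContDiff ℝ ∞ fun s => (starRingEnd ℂ) (A s) := contDiff_conj.comp hA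
  have hRc : ContDiff ℝ ∞ fun s => (starRingEnd ℂ) (R s) := contDiff_conj.comp hR
  have hof {α β v : ℂ → ℂ} (hα : ContDiff ℝ ∞ α) (hβ : ContDiff ℝ ∞ β) (hv : ContDiff ℝ ∞ v) :
      ContDiffOn ℝ ∞ (fun s => ofLight (α s) (β s) (v s)) (Metric.closedBall 0 1) :=
    (contDiff_ofLight.comp (hα.prodMk (hβ.prodMk hv))).contDiffOn
  have hAB (s : ℂ) : A s * B s = 1 - ζ s ^ (n + 1) := by
    have h1 := geom_sum_mul (ζ s) (n + 1)
    have h2 : ζ s - 1 = s * (starRingEnd ℂ) s * (w - 1) := by simp [ζ]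
    rw [h2] at h1
    have h3 : A s * B s = s * ((starRingEnd ℂ) s *
        (-(w - 1) * ∑ i ∈ Finset.range (n + 1), ζ s ^ i)) := by
      simp only [A, B]; field_simp
    rw [h3]
    linear_combination -h1
  have hmem (s : ℂ) : ofLight (A s) (B s) (ζ s) ∈ W n := ofLight_mem_W.2 (hAB s)
  -- A vanishes only at the centre, where ζ = 1 and R = n + 1; so A and R have no common zero.
  have hAR (s : ℂ) : 0 < 2 * ‖A s‖ ^ 2 + ‖R s‖ ^ 2 := by
    by_cases hs : s = 0
    · have hn : (n : ℂ) + 1 ≠ 0 := by exact_mod_cast Nat.succ_ne_zero n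
      have : R s ≠ 0 := by simpa [R, ζ, hs] using hn
      positivity
    · have : A s ≠ 0 := mul_ne_zero hs ha
      positivity
  have hARc (s : ℂ) : 2 * (A s * (starRingEnd ℂ) (A s)) + R s * (starRingEnd ℂ) (R s) ≠ 0 := by
    rw [Complex.mul_conj', Complex.mul_conj']
    exact_mod_cast (hAR s).ne'
  -- Tangency of (α, β, v) means Aβ + Bα + Rv = 0. The field e is the solution with α = 0, and f is
  -- the solution orthogonal to it, scaled by 2|A|² + |R|² to clear denominators; the 2 reflects the
  -- weight 1/2 in `herm_ofLight`.
  obtain ⟨Φ, hΦ⟩ := exists_trivialization_of_orthogonal_frame (M := W n)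
    (ψ := fun s => ofLight (A s) (B s) (ζ s)) (G := fun s => grad n (ofLight (A s) (B s) (ζ s)))
    (e := fun s => ofLight 0 (R s) (-A s))
    (f := fun s => ofLight (2 * (A s * (starRingEnd ℂ) (A s)) + R s * (starRingEnd ℂ) (R s))
      (-2 * B s * (starRingEnd ℂ) (A s)) (-B s * (starRingEnd ℂ) (R s)))
    (fun s _ => ⟨grad_ne_zero (hmem s), tangentVectors_W (hmem s)⟩)
    (hof contDiff_const hR hA.neg) (hof (by fun_prop) (by fun_prop) (by fun_prop))
    (fun s _ h => by
      rw [ofLight_eq_zero_iff] at h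
      apply hARc s
      rw [h.2.1, neg_eq_zero.1 h.2.2]; simp)
    (fun s _ h => hARc s (ofLight_eq_zero_iff.1 h).1)
    (fun s _ => by rw [herm_ofLight]; simp; ring)
    (fun s _ => by rw [linForm_grad_ofLight]; simp only [R]; ring)
    (fun s _ => by rw [linForm_grad_ofLight]; simp only [R]; ring)
  refine ⟨_, Φ, ⟨hof hA hB hζ, fun s _ => hmem s, fun t => ?_⟩, hΦ⟩
  have ht : 2 * Real.pi * (t / (2 * Real.pi)) = t := by
    have := Real.pi_pos; field_simp
  rw [ht, rotation_ofLight]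
  have hs : Complex.exp (Complex.I * t) * (starRingEnd ℂ) (Complex.exp (Complex.I * t)) = 1 := by
    rw [Complex.mul_conj', mul_comm, Complex.norm_exp_ofReal_mul_I]; simp
  generalize Complex.exp (Complex.I * t) = s at *
  have hζs : ζ s = w := by simp only [ζ, hs]; ring
  have hBs : B s = (starRingEnd ℂ) s * b := by
    have h1 := geom_sum_mul w (n + 1)
    simp only [B, hζs]
    rw [div_eq_iff ha]
    linear_combination (starRingEnd ℂ) s * (-h1 - hp)
  rw [hζs, hBs]

/-- The reflection `z₁ ↦ -z₁`. -/
def reflection : (Fin 3 → ℂ) →L[ℝ] (Fin 3 → ℂ) :=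
  ContinuousLinearMap.pi ![ContinuousLinearMap.proj 0, -ContinuousLinearMap.proj 1,
    ContinuousLinearMap.proj 2]

theorem reflection_apply (z : Fin 3 → ℂ) : reflection z = ![z 0, -z 1, z 2] := by
  ext i; fin_cases i <;> simp [reflection]

theorem reflection_reflection (z : Fin 3 → ℂ) : reflection (reflection z) = z := by
  ext i; fin_cases i <;> simp [reflection_apply]

theorem reflection_mem_W {n : ℕ} {z : Fin 3 → ℂ} (hz : z ∈ W n) : reflection z ∈ W n := by
  simpa [mem_W_iff, reflection_apply] using hz

/-- The reflection exchanges a and b and reverses the rotation; conjugating the disc parameter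
restores the orientation of the orbit. -/
theorem reflection_rotation (θ : Real.Angle) (z : Fin 3 → ℂ) :
    reflection (rotation θ z) = rotation (-θ) (reflection z) := by
  ext i; fin_cases i <;> simp [reflection_apply, rotation]
  ring

theorem stdForm_reflection (u v : Fin 3 → ℂ) :
    stdForm (reflection u) (reflection v) = stdForm u v := by
  simp [stdForm, Fin.sum_univ_three, reflection_apply]

theorem linForm_grad_reflection (n : ℕ) (z v : Fin 3 → ℂ) :
    linForm (grad n (reflection z)) (reflection v) = linForm (grad n z) v := by
  simp [linForm_apply, grad, reflection_apply]

/-- Off the fixed points a or b is nonzero; the case a = 0 is carried to b = 0 by the reflection. -/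
theorem exists_disc {n : ℕ} {p : Fin 3 → ℂ} (hp : p ∈ W n) (hfix : ¬(p 0 = 0 ∧ p 1 = 0)) :
    ∃ ψ Φ, IsFillingDisc (W n) rotation p (2 * Real.pi) ψ ∧
      IsSymplecticTrivialization (W n) ψ Φ := by
  by_cases ha : p 0 + Complex.I * p 1 = 0
  · have hb : reflection p 0 + Complex.I * reflection p 1 ≠ 0 := by
      intro hb
      simp only [reflection_apply, Matrix.cons_val] at hb
      refine hfix ⟨by linear_combination (ha + hb) / 2, ?_⟩
      have : Complex.I * p 1 = 0 := by linear_combination (ha - hb) / 2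
      simpa using this
    obtain ⟨ψ, Φ, hψ, hΦ⟩ := exists_disc_of_left_ne_zero (reflection_mem_W hp) hb
    have hball {s : ℂ} (hs : s ∈ Metric.closedBall (0 : ℂ) 1) :
        (starRingEnd ℂ) s ∈ Metric.closedBall (0 : ℂ) 1 := by simpa using hs
    have hc : Set.MapsTo (fun s : ℂ => (starRingEnd ℂ) s) (Metric.closedBall 0 1)
      (Metric.closedBall 0 1) := fun s => hball
    refine ⟨fun s => reflection (ψ ((starRingEnd ℂ) s)),
      fun s => reflection.comp (Φ ((starRingEnd ℂ) s)), ⟨?_, ?_, ?_⟩, ⟨?_, ?_, ?_⟩⟩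
    · exact reflection.contDiff.comp_contDiffOn (hψ.smooth.comp contDiff_conj.contDiffOn hc)
    · exact fun s hs => reflection_mem_W (hψ.mapsTo _ (hball hs))
    · intro t
      have h1 : (starRingEnd ℂ) (Complex.exp (Complex.I * t)) =
          Complex.exp (Complex.I * ((-t : ℝ) : ℂ)) := by
        rw [← Complex.exp_conj]; simp
      rw [h1, hψ.boundary, reflection_rotation, reflection_reflection, ← Real.Angle.coe_neg]
      congr 2
      ring
    · exact contDiffOn_const.clm_comp (hΦ.smooth.comp contDiff_conj.contDiffOn hc)
    · intro s hs
      have h1 := hΦ.range_eq _ (hball hs)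
      have hm := hψ.mapsTo _ (hball hs)
      rw [tangentVectors_W (reflection_mem_W hm)]
      rw [tangentVectors_W hm] at h1
      ext v
      constructor
      · rintro ⟨c, rfl⟩
        have : Φ ((starRingEnd ℂ) s) c ∈ Set.range (Φ ((starRingEnd ℂ) s)) := ⟨c, rfl⟩
        rw [h1] at this
        exact (linForm_grad_reflection _ _ _).trans this
      · intro hv
        have hv' : linForm (grad n (ψ ((starRingEnd ℂ) s))) (reflection v) = 0 := by
          rw [← linForm_grad_reflection, reflection_reflection]; exact hv
        have : reflection v ∈ Set.range (Φ ((starRingEnd ℂ) s)) := by rw [h1]; exact hv'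
        obtain ⟨c, hc⟩ := this
        exact ⟨c, by simp [hc, reflection_reflection]⟩
    · intro s hs a b
      simpa [stdForm_reflection] using hΦ.symplectic _ (hball hs) a b
  · exact exists_disc_of_left_ne_zero hp ha

/-! ### Linear and antilinear parts of a symplectic map. -/

/-- The complex linear part of a real linear map. -/
def linPart {k N : ℕ} (Φ : (Fin k → ℂ) →L[ℝ] (Fin N → ℂ)) (a : Fin k → ℂ) : Fin N → ℂ :=
  (1 / 2 : ℂ) • (Φ a - Complex.I • Φ (Complex.I • a))

/-- The complex antilinear part of a real linear map. -/
def antiPart {k N : ℕ} (Φ : (Fin k → ℂ) →L[ℝ] (Fin N → ℂ)) (a : Fin k → ℂ) : Fin N → ℂ :=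
  (1 / 2 : ℂ) • (Φ a + Complex.I • Φ (Complex.I • a))

section parts
variable {k N : ℕ} (Φ : (Fin k → ℂ) →L[ℝ] (Fin N → ℂ)) (a b : Fin k → ℂ) (c : ℂ)

theorem linPart_add_antiPart : linPart Φ a + antiPart Φ a = Φ a := by
  ext i; simp [linPart, antiPart]; ring

theorem apply_smul_complex : Φ (c • a) = (c.re : ℂ) • Φ a + (c.im : ℂ) • Φ (Complex.I • a) := by
  have : c • a = c.re • a + c.im • (Complex.I • a) := by
    ext i
    simp only [Pi.smul_apply, Pi.add_apply, smul_eq_mul, Complex.real_smul]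
    conv_lhs => rw [← Complex.re_add_im c]
    ring
  rw [this, map_add, map_smul, map_smul]
  ext i; simp

theorem linPart_add : linPart Φ (a + b) = linPart Φ a + linPart Φ b := by
  ext i; simp [linPart]; ring

theorem antiPart_add : antiPart Φ (a + b) = antiPart Φ a + antiPart Φ b := by
  ext i; simp [antiPart]; ring

theorem linPart_smul : linPart Φ (c • a) = c • linPart Φ a := by
  ext i
  have h : Complex.I • c • a = (Complex.I * c) • a := smul_smul _ _ _
  rw [linPart, linPart, h, apply_smul_complex Φ a c, apply_smul_complex Φ a (Complex.I * c)]
  simp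
  conv_rhs => rw [← Complex.re_add_im c]
  linear_combination (1 / 2) * (c.im : ℂ) * Φ (Complex.I • a) i * Complex.I_sq

theorem antiPart_smul : antiPart Φ (c • a) = (starRingEnd ℂ) c • antiPart Φ a := by
  ext i
  have h : Complex.I • c • a = (Complex.I * c) • a := smul_smul _ _ _
  rw [antiPart, antiPart, h, apply_smul_complex Φ a c, apply_smul_complex Φ a (Complex.I * c)]
  have hc : (starRingEnd ℂ) c = c.re - c.im * Complex.I := by apply Complex.ext <;> simp
  rw [hc]
  simp
  linear_combination ((1 / 2) * (c.im : ℂ) * Φ (Complex.I • a) i) * Complex.I_sq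

variable {Φ}

/-- Comparing the symplectic identity on (a, b), (ia, ib), (a, ib) and (ia, b) separates the terms
PP, QQ from the mixed terms PQ, because P and Q scale by c and conj c. -/
theorem herm_parts (hΦ : ∀ a b, stdForm (Φ a) (Φ b) = stdForm a b) :
    (herm (linPart Φ a) (linPart Φ b)).re - (herm (antiPart Φ a) (antiPart Φ b)).re =
      (herm a b).re ∧ herm (antiPart Φ a) (linPart Φ b) = herm (antiPart Φ b) (linPart Φ a) := by
  have h1 := hΦ a b
  have h2 := hΦ (Complex.I • a) (Complex.I • b)
  have h3 := hΦ a (Complex.I • b)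
  have h4 := hΦ (Complex.I • a) b
  simp only [stdForm_eq_im, ← linPart_add_antiPart, linPart_smul, antiPart_smul, herm_add_left,
    herm_add_right, herm_smul_left, herm_smul_right, Complex.conj_I, map_neg] at h1 h2 h3 h4
  rw [← herm_conj (linPart Φ a) (antiPart Φ b)]
  simp at h1 h2 h3 h4
  refine ⟨by linarith, Complex.ext ?_ ?_⟩
  · rw [Complex.conj_re]; linarith
  · rw [Complex.conj_im]; linarith

theorem nsq_linPart (hΦ : ∀ a b, stdForm (Φ a) (Φ b) = stdForm a b) :
    nsq (linPart Φ a) = nsq a + nsq (antiPart Φ a) := by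
  have := (herm_parts a a hΦ).1
  simp only [herm_self, Complex.ofReal_re] at this
  linarith

end parts

theorem volForm_smul_smul (g u v : Fin 3 → ℂ) (c d : ℂ) :
    volForm g (c • u) (d • v) = c * d * volForm g u v := by
  simp [volForm_apply]; ring

/-- Scaling the antilinear part of a symplectic map by `τ ∈ [0, 1]`, the image of a Lagrangian
plane stays totally real. -/
theorem volForm_interpolation_ne_zero {Φ : (Fin 2 → ℂ) →L[ℝ] (Fin 3 → ℂ)} {g : Fin 3 → ℂ}
    (hg : g ≠ 0) (hΦ : ∀ a b, stdForm (Φ a) (Φ b) = stdForm a b)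
    (hker : ∀ a, linForm g (Φ a) = 0) {a b : Fin 2 → ℂ} (ha : nsq a = 1) (hb : nsq b = 1)
    (hab : herm a b = 0) {τ : ℝ} (hτ : τ ∈ Set.Icc (0 : ℝ) 1) :
    volForm g (linPart Φ a + (τ : ℂ) • antiPart Φ a) (linPart Φ b + (τ : ℂ) • antiPart Φ b) ≠ 0 := by
  have hmem (a : Fin 2 → ℂ) : linForm g (linPart Φ a + (τ : ℂ) • antiPart Φ a) = 0 := by
    simp only [linPart, antiPart, map_add, linForm_smul, map_sub, hker]
    ring
  intro h0
  obtain ⟨x, y, hxy, h⟩ := exists_dependence_of_volForm_eq_zero hg (hmem a) (hmem b) h0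
  have hn (x y : ℂ) : nsq (x • a + y • b) = ‖x‖ ^ 2 + ‖y‖ ^ 2 := by
    have hba : herm b a = 0 := by rw [← herm_conj, hab, map_zero]
    have : (nsq (x • a + y • b) : ℂ) = ((‖x‖ ^ 2 + ‖y‖ ^ 2 : ℝ) : ℂ) := by
      have haa : herm a a = 1 := by rw [herm_self, ha, Complex.ofReal_one]
      have hbb : herm b b = 1 := by rw [herm_self, hb, Complex.ofReal_one]
      rw [← herm_self]
      simp only [herm_add_left, herm_add_right, herm_smul_left, herm_smul_right, hab, hba, haa, hbb]
      push_cast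
      rw [← Complex.mul_conj', ← Complex.mul_conj']
      ring
    exact_mod_cast this
  set u := x • a + y • b with hu
  set w := (starRingEnd ℂ) x • a + (starRingEnd ℂ) y • b with hw
  -- Since the antilinear part conjugates coefficients, the dependence reads P u = −τ Q w, with w
  -- the combination with conjugate coefficients.
  have hP : linPart Φ u = ((-τ : ℝ) : ℂ) • antiPart Φ w := by
    rw [hu, hw, linPart_add, antiPart_add, linPart_smul, linPart_smul, antiPart_smul, antiPart_smul,
      Complex.conj_conj, Complex.conj_conj]
    ext i
    have := congrFun h i
    simp at this ⊢
    linear_combination this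
  have hnu : nsq u = ‖x‖ ^ 2 + ‖y‖ ^ 2 := hn x y
  have hnw : nsq w = ‖x‖ ^ 2 + ‖y‖ ^ 2 := by rw [hw, hn]; simp
  have hm : 0 < ‖x‖ ^ 2 + ‖y‖ ^ 2 := by
    rcases hxy with h | h <;> positivity
  set m := ‖x‖ ^ 2 + ‖y‖ ^ 2
  have h1 := nsq_linPart u hΦ
  have h2 := nsq_linPart w hΦ
  have h3 := (herm_parts u w hΦ).2
  -- Let m = |u|² = |w|², q = |Qw|², r = |Qu|². Then r = τ²q − m, and by symmetry of the mixed term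
  -- Cauchy–Schwarz gives τ²q² ≤ r(m + q). Together, m² + mq(1 − τ²) ≤ 0, which contradicts m > 0.
  have h4 := norm_herm_sq_le (antiPart Φ u) (linPart Φ w)
  rw [h3, hP, herm_smul_right, herm_self, norm_mul, Complex.norm_real, Complex.norm_real,
    mul_pow, Real.norm_eq_abs, Real.norm_eq_abs, sq_abs, sq_abs, h2, hnw] at h4
  rw [hP, nsq_smul, Complex.norm_real, Real.norm_eq_abs, sq_abs, hnu] at h1
  have hq := nsq_nonneg (antiPart Φ w)
  generalize nsq (antiPart Φ w) = q at *
  generalize nsq (antiPart Φ u) = r at *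
  have hτ2 : τ ^ 2 ≤ 1 := by nlinarith [hτ.1, hτ.2]
  have hr : r = τ ^ 2 * q - m := by linarith
  subst hr
  nlinarith [mul_nonneg (mul_nonneg hm.le hq) (sub_nonneg.2 hτ2), mul_pos hm hm]

/-! ### Continuous logarithms along homotopies. -/

/-- The endpoints of a homotopy of nonvanishing functions differ by the exponential of a continuous
function. -/
theorem exists_log_of_homotopy {K : Set ℝ} (hK : IsCompact K) {F : ℝ → ℝ → ℂ}
    (hF : ContinuousOn (Function.uncurry F) (Set.Icc 0 1 ×ˢ K))
    (hF0 : ∀ r ∈ Set.Icc (0 : ℝ) 1, ∀ t ∈ K, F r t ≠ 0) :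
    ∃ l : ℝ → ℂ, ContinuousOn l K ∧ (∀ t ∈ K, F 1 t = F 0 t * Complex.exp (l t)) ∧
      ∀ t u, (∀ r, F r t = F r u) → l t = l u := by
  have hc : IsCompact (Set.Icc (0 : ℝ) 1 ×ˢ K) := isCompact_Icc.prod hK
  obtain ⟨δ, hδ, hδF⟩ : ∃ δ > 0, ∀ x ∈ Set.Icc (0 : ℝ) 1 ×ˢ K, δ ≤ ‖F x.1 x.2‖ := by
    rcases (Set.Icc (0 : ℝ) 1 ×ˢ K).eq_empty_or_nonempty with he | hne
    · exact ⟨1, one_pos, by simp [he]⟩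
    · obtain ⟨x, hx, hmin⟩ := hc.exists_isMinOn hne hF.norm
      exact ⟨_, norm_pos_iff.2 (hF0 x.1 hx.1 x.2 hx.2), fun y hy => hmin hy⟩
  obtain ⟨η, hη, hηF⟩ := Metric.uniformContinuousOn_iff.1
    (hc.uniformContinuousOn_of_continuous hF) δ hδ
  -- The mesh is so fine that consecutive slices differ by less than the lower bound δ of |F|; their
  -- quotient is then within 1 of 1, and its principal logarithm is continuous.
  obtain ⟨m, hm⟩ := exists_nat_one_div_lt hη
  set d : ℝ := (m : ℝ) + 1 with hd
  have hd0 : 0 < d := by positivity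
  have hI (i : ℕ) (hi : i ≤ m + 1) : (i : ℝ) / d ∈ Set.Icc (0 : ℝ) 1 := by
    refine ⟨by positivity, (div_le_one hd0).2 ?_⟩
    rw [hd]; exact_mod_cast hi
  have hslit (i : ℕ) (hi : i < m + 1) (t : ℝ) (ht : t ∈ K) :
      F ((i + 1 : ℕ) / d) t / F (i / d) t ∈ Complex.slitPlane := by
    have h1 := hI i hi.le
    have h2 := hI (i + 1) hi
    have hne := hF0 _ h1 t ht
    have hdist : dist (((i + 1 : ℕ) / d : ℝ), t) ((i / d : ℝ), t) < η := by
      rw [Prod.dist_eq, dist_self, Real.dist_eq]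
      have : ((i + 1 : ℕ) : ℝ) / d - i / d = 1 / d := by push_cast; ring
      rw [this, abs_of_pos (by positivity), max_eq_left (by positivity)]
      exact hm
    have h3 := hηF _ ⟨h2, ht⟩ _ ⟨h1, ht⟩ hdist
    have h4 := hδF _ (Set.mk_mem_prod h1 ht)
    rw [dist_eq_norm] at h3
    have h5 : ‖F ((i + 1 : ℕ) / d) t / F (i / d) t - 1‖ < 1 := by
      rw [div_sub_one hne, norm_div, div_lt_one (norm_pos_iff.2 hne)]
      exact h3.trans_le h4
    have := Complex.mem_slitPlane_of_norm_lt_one h5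
    simpa using this
  refine ⟨fun t => ∑ i ∈ Finset.range (m + 1), Complex.log (F ((i + 1 : ℕ) / d) t / F (i / d) t),
    ?_, ?_, ?_⟩
  · have hs (i : ℕ) (hi : i ≤ m + 1) : ContinuousOn (fun t => F (i / d) t) K :=
      hF.comp (continuousOn_const.prodMk continuousOn_id) fun t ht => ⟨hI i hi, ht⟩
    refine continuousOn_finsetSum _ fun i hi => ?_
    have hi' := Finset.mem_range.1 hi
    exact ContinuousOn.clog ((hs _ hi').div (hs _ hi'.le) fun t ht => hF0 _ (hI i hi'.le) t ht)
      fun t ht => hslit i hi' t ht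
  · intro t ht
    have key (j : ℕ) (hj : j ≤ m + 1) : F (j / d) t = F 0 t * Complex.exp
        (∑ i ∈ Finset.range j, Complex.log (F ((i + 1 : ℕ) / d) t / F (i / d) t)) := by
      induction j with
      | zero => simp
      | succ j ih =>
        have h1 := hslit j hj t ht
        rw [Finset.sum_range_succ, Complex.exp_add, ← mul_assoc, ← ih (by lia),
          Complex.exp_log (Complex.slitPlane_ne_zero h1)]
        rw [mul_div_cancel₀ _ (hF0 _ (hI j (by lia)) t ht)]
    have := key (m + 1) le_rfl
    rw [← this]
    congr 1
    rw [hd]; push_cast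
    exact (div_self (by positivity)).symm
  -- The logarithm is built pointwise from values of F, so it inherits any coincidence of them; this
  -- is the source of periodicity later.
  · intro t u h
    simp only [h]

/-! ### Unitary frames of Lagrangian planes. -/

theorem continuous_nsq {N : ℕ} : Continuous fun x : Fin N → ℂ => nsq x := by
  unfold nsq
  fun_prop

/-- The second vector of the Gram–Schmidt process, before normalisation. -/
def gramVec {N : ℕ} (x y : Fin N → ℂ) : Fin N → ℂ := y - ((herm x y).re / nsq x) • x

/-- The normalisation of a vector. -/
def unitVec {N : ℕ} (x : Fin N → ℂ) : Fin N → ℂ := (√(nsq x))⁻¹ • x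

theorem real_smul_eq {N : ℕ} (r : ℝ) (x : Fin N → ℂ) : r • x = (r : ℂ) • x := by
  ext i; simp

theorem nsq_unitVec {N : ℕ} {x : Fin N → ℂ} (hx : x ≠ 0) : nsq (unitVec x) = 1 := by
  rw [unitVec, real_smul_eq, nsq_smul, Complex.norm_real, Real.norm_eq_abs, sq_abs, inv_pow,
    Real.sq_sqrt (nsq_nonneg x)]
  exact inv_mul_cancel₀ (nsq_pos hx).ne'

/-- On a Lagrangian plane the Hermitian product is real, so a Gram–Schmidt step with a real
coefficient, which keeps the real span, already gives Hermitian orthogonality. -/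
theorem herm_unitVec_gramVec {N : ℕ} {x y : Fin N → ℂ} (hx : x ≠ 0) (h : stdForm x y = 0) :
    herm (unitVec x) (unitVec (gramVec x y)) = 0 := by
  have h1 : herm x (gramVec x y) = 0 := by
    rw [stdForm_eq_im] at h
    have h2 : ((herm x y).re : ℂ) = herm x y := Complex.ext (by simp) (by simp [h])
    have h3 : (nsq x : ℂ) ≠ 0 := by exact_mod_cast (nsq_pos hx).ne'
    have h4 : gramVec x y = y + (-((herm x y).re / nsq x : ℝ) : ℂ) • x := by
      rw [gramVec, real_smul_eq, neg_smul, sub_eq_add_neg]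
    rw [h4, herm_add_right, herm_smul_right, herm_self]
    push_cast
    rw [h2]
    field_simp
    ring
  rw [unitVec, unitVec, real_smul_eq, real_smul_eq, herm_smul_left, herm_smul_right, h1]
  simp

theorem span_unitVec_gramVec {N : ℕ} {x y : Fin N → ℂ} (hx : x ≠ 0) (hy : gramVec x y ≠ 0) :
    Submodule.span ℝ {unitVec x, unitVec (gramVec x y)} = Submodule.span ℝ {x, y} := by
  have h1 : √(nsq x) ≠ 0 := (Real.sqrt_pos.2 (nsq_pos hx)).ne'
  have h2 : √(nsq (gramVec x y)) ≠ 0 := (Real.sqrt_pos.2 (nsq_pos hy)).ne'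
  have hx' : √(nsq x) • unitVec x = x := by rw [unitVec, smul_smul, mul_inv_cancel₀ h1, one_smul]
  have hy' : √(nsq (gramVec x y)) • unitVec (gramVec x y) = gramVec x y := by
    rw [unitVec, smul_smul, mul_inv_cancel₀ h2, one_smul]
  apply le_antisymm <;> rw [Submodule.span_le, Set.pair_subset_iff]
  · have m1 : x ∈ Submodule.span ℝ {x, y} := Submodule.subset_span (by simp)
    have m2 : y ∈ Submodule.span ℝ {x, y} := Submodule.subset_span (by simp)
    exact ⟨Submodule.smul_mem _ _ m1,
      Submodule.smul_mem _ _ (Submodule.sub_mem _ m2 (Submodule.smul_mem _ _ m1))⟩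
  · have m1 : unitVec x ∈ Submodule.span ℝ {unitVec x, unitVec (gramVec x y)} :=
      Submodule.subset_span (by simp)
    have m2 : unitVec (gramVec x y) ∈ Submodule.span ℝ {unitVec x, unitVec (gramVec x y)} :=
      Submodule.subset_span (by simp)
    have m3 := Submodule.smul_mem _ (√(nsq x)) m1
    have m4 := Submodule.smul_mem _ (√(nsq (gramVec x y))) m2
    rw [hx'] at m3
    rw [hy'] at m4
    refine ⟨m3, ?_⟩
    have : y = gramVec x y + ((herm x y).re / nsq x) • x := by simp [gramVec]
    have m5 := Submodule.add_mem _ m4 (Submodule.smul_mem _ ((herm x y).re / nsq x) m3)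
    rwa [← this] at m5

/-- The matrix with columns `a` and `b`. -/
def colMatrix (a b : Fin 2 → ℂ) : Matrix (Fin 2) (Fin 2) ℂ := (Matrix.of ![a, b]).transpose

theorem range_transpose_colMatrix (a b : Fin 2 → ℂ) :
    Set.range (colMatrix a b).transpose = {a, b} := by
  exact Matrix.range_cons_cons_empty a b ![]

theorem colMatrix_mem_unitaryGroup {a b : Fin 2 → ℂ} (ha : nsq a = 1) (hb : nsq b = 1)
    (hab : herm a b = 0) : colMatrix a b ∈ Matrix.unitaryGroup (Fin 2) ℂ := by
  have hba : herm b a = 0 := by rw [← herm_conj, hab, map_zero]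
  have haa : herm a a = 1 := by rw [herm_self, ha]; simp
  have hbb : herm b b = 1 := by rw [herm_self, hb]; simp
  rw [herm_eq_sum, Fin.sum_univ_two] at hab hba haa hbb
  rw [Matrix.mem_unitaryGroup_iff']
  ext i j
  fin_cases i <;> fin_cases j <;>
    simpa [colMatrix, Matrix.mul_apply, Fin.sum_univ_two, Matrix.star_eq_conjTranspose]

/-- The pullback of Ω by a complex linear map is alternating and complex bilinear on ℂ², hence a
multiple of the determinant. -/
theorem volForm_linPart (g : Fin 3 → ℂ) (Φ : (Fin 2 → ℂ) →L[ℝ] (Fin 3 → ℂ)) (a b : Fin 2 → ℂ) :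
    volForm g (linPart Φ a) (linPart Φ b) =
      (colMatrix a b).det * volForm g (linPart Φ ![1, 0]) (linPart Φ ![0, 1]) := by
  have h (a : Fin 2 → ℂ) : linPart Φ a = a 0 • linPart Φ ![1, 0] + a 1 • linPart Φ ![0, 1] := by
    rw [← linPart_smul, ← linPart_smul, ← linPart_add]
    congr 1
    ext i; fin_cases i <;> simp
  rw [h a, h b]
  simp [volForm_apply, colMatrix, Matrix.det_fin_two]
  ring

theorem eq_exp_of_norm_eq_one {z w : ℂ} {r : ℝ} (hr : 0 < r) (hz : ‖z‖ = 1)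
    (h : z = r * Complex.exp w) : z = Complex.exp (Complex.I * w.im) := by
  have hw : Complex.exp w = Real.exp w.re * Complex.exp (Complex.I * w.im) := by
    rw [Complex.ofReal_exp, ← Complex.exp_add, mul_comm Complex.I, Complex.re_add_im]
  have h1 : r * Real.exp w.re = 1 := by
    rw [← hz, h, norm_mul, Complex.norm_exp, Complex.norm_real, Real.norm_of_nonneg hr.le]
  rw [h, hw, ← mul_assoc]
  have : (r : ℂ) * (Real.exp w.re : ℂ) = 1 := by exact_mod_cast h1
  rw [this, one_mul]

theorem norm_det_of_mem_unitaryGroup {A : Matrix (Fin 2) (Fin 2) ℂ}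
    (hA : A ∈ Matrix.unitaryGroup (Fin 2) ℂ) : ‖A.det‖ = 1 := by
  have h := Matrix.det_of_mem_unitary hA
  exact CStarRing.norm_of_mem_unitary h

section continuity
variable {X : Type*} [TopologicalSpace X] {s : Set X} {k N : ℕ}

theorem ContinuousOn.linPart {Φ : X → (Fin k → ℂ) →L[ℝ] (Fin N → ℂ)} {a : X → Fin k → ℂ}
    (hΦ : ContinuousOn Φ s) (ha : ContinuousOn a s) :
    ContinuousOn (fun x => linPart (Φ x) (a x)) s := by
  have h1 := hΦ.clm_apply ha
  have h2 := (hΦ.clm_apply (ha.const_smul Complex.I)).const_smul Complex.I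
  exact (h1.sub h2).const_smul (1 / 2 : ℂ)

theorem ContinuousOn.antiPart {Φ : X → (Fin k → ℂ) →L[ℝ] (Fin N → ℂ)} {a : X → Fin k → ℂ}
    (hΦ : ContinuousOn Φ s) (ha : ContinuousOn a s) :
    ContinuousOn (fun x => antiPart (Φ x) (a x)) s := by
  have h1 := hΦ.clm_apply ha
  have h2 := (hΦ.clm_apply (ha.const_smul Complex.I)).const_smul Complex.I
  exact (h1.add h2).const_smul (1 / 2 : ℂ)

theorem ContinuousOn.herm {x y : X → Fin N → ℂ} (hx : ContinuousOn x s) (hy : ContinuousOn y s) :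
    ContinuousOn (fun t => herm (x t) (y t)) s := by
  simp only [herm_eq_sum]
  exact continuousOn_finsetSum _ fun j _ =>
    (Complex.continuous_conj.comp_continuousOn (continuousOn_pi.1 hx j)).mul (continuousOn_pi.1 hy j)

theorem ContinuousOn.volForm {g u v : X → Fin 3 → ℂ} (hg : ContinuousOn g s)
    (hu : ContinuousOn u s) (hv : ContinuousOn v s) :
    ContinuousOn (fun t => volForm (g t) (u t) (v t)) s := by
  simp only [volForm_apply]
  have hc (i : Fin 3) := Complex.continuous_conj.comp_continuousOn (continuousOn_pi.1 hg i)
  have hu' := continuousOn_pi.1 hu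
  have hv' := continuousOn_pi.1 hv
  exact (((hc 0).mul (((hu' 1).mul (hv' 2)).sub ((hu' 2).mul (hv' 1)))).add
    ((hc 1).mul (((hu' 2).mul (hv' 0)).sub ((hu' 0).mul (hv' 2))))).add
    ((hc 2).mul (((hu' 0).mul (hv' 1)).sub ((hu' 1).mul (hv' 0))))

theorem ContinuousOn.gramVec {x y : X → Fin N → ℂ} (hx : ContinuousOn x s) (hy : ContinuousOn y s)
    (hx0 : ∀ t ∈ s, x t ≠ 0) : ContinuousOn (fun t => gramVec (x t) (y t)) s := by
  have h1 : ContinuousOn (fun t => (SpecialHam.herm (x t) (y t)).re) s :=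
    Complex.continuous_re.comp_continuousOn (ContinuousOn.herm hx hy)
  have h2 : ContinuousOn (fun t => nsq (x t)) s := continuous_nsq.comp_continuousOn hx
  exact hy.sub ((h1.div h2 fun t ht => (nsq_pos (hx0 t ht)).ne').smul hx)

end continuity

theorem ContinuousOn.unitVec {X : Type*} [TopologicalSpace X] {s : Set X} {N : ℕ}
    {x : X → Fin N → ℂ} (hx : ContinuousOn x s) (hx0 : ∀ t ∈ s, x t ≠ 0) :
    ContinuousOn (fun t => unitVec (x t)) s := by
  unfold SpecialHam.unitVec
  exact ((Real.continuous_sqrt.comp_continuousOn (continuous_nsq.comp_continuousOn hx)).inv₀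
    fun t ht => (Real.sqrt_pos.2 (nsq_pos (hx0 t ht))).ne').smul hx

theorem ContinuousOn.colMatrix {X : Type*} [TopologicalSpace X] {s : Set X}
    {a b : X → Fin 2 → ℂ} (ha : ContinuousOn a s) (hb : ContinuousOn b s) :
    ContinuousOn (fun t => colMatrix (a t) (b t)) s := by
  refine continuousOn_pi.2 fun i => continuousOn_pi.2 fun j => ?_
  fin_cases j
  · exact continuousOn_pi.1 ha i
  · exact continuousOn_pi.1 hb i

theorem exp_I_mul_mem_closedBall (t : ℝ) :
    Complex.exp (Complex.I * t) ∈ Metric.closedBall (0 : ℂ) 1 := by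
  rw [mem_closedBall_zero_iff, mul_comm Complex.I, Complex.norm_exp_ofReal_mul_I]

theorem exp_I_mul_two_pi :
    Complex.exp (Complex.I * ((2 * Real.pi : ℝ) : ℂ)) = Complex.exp (Complex.I * ((0 : ℝ) : ℂ)) := by
  rw [mul_comm]
  push_cast
  rw [Complex.exp_two_pi_mul_I]
  simp

/-! ### Maslov index from the phase of the 2-form. -/

/-- `Φ` is a continuous family of symplectic maps from `ℂ²` to the kernels of nonzero complex
linear forms `G`, over the closed unit disc. -/
structure IsSymplecticFamily (Φ : ℂ → (Fin 2 → ℂ) →L[ℝ] (Fin 3 → ℂ)) (G : ℂ → Fin 3 → ℂ) :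
    Prop where
  continuousOn : ContinuousOn Φ (Metric.closedBall 0 1)
  continuousOn_form : ContinuousOn G (Metric.closedBall 0 1)
  form_ne_zero : ∀ s ∈ Metric.closedBall (0 : ℂ) 1, G s ≠ 0
  linForm_apply : ∀ s ∈ Metric.closedBall (0 : ℂ) 1, ∀ a, linForm (G s) (Φ s a) = 0
  symplectic : ∀ s ∈ Metric.closedBall (0 : ℂ) 1, ∀ a b, stdForm (Φ s a) (Φ s b) = stdForm a b

/-- Along the boundary of the disc, the determinant of the linear part has a periodic logarithm. -/
theorem IsSymplecticFamily.exists_log_linPart {Φ : ℂ → (Fin 2 → ℂ) →L[ℝ] (Fin 3 → ℂ)}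
    {G : ℂ → Fin 3 → ℂ} (h : IsSymplecticFamily Φ G) :
    ∃ (k : ℂ) (l : ℝ → ℂ), k ≠ 0 ∧ ContinuousOn l (Set.Icc 0 (2 * Real.pi)) ∧
      l (2 * Real.pi) = l 0 ∧ ∀ t ∈ Set.Icc 0 (2 * Real.pi),
        volForm (G (Complex.exp (Complex.I * t)))
          (linPart (Φ (Complex.exp (Complex.I * t))) ![1, 0])
          (linPart (Φ (Complex.exp (Complex.I * t))) ![0, 1]) = k * Complex.exp (l t) := by
  have hball (r t : ℝ) (hr : r ∈ Set.Icc (0 : ℝ) 1) :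
      (r : ℂ) * Complex.exp (Complex.I * t) ∈ Metric.closedBall (0 : ℂ) 1 := by
    rw [mem_closedBall_zero_iff, norm_mul, mul_comm Complex.I, Complex.norm_exp_ofReal_mul_I,
      mul_one, Complex.norm_real, Real.norm_of_nonneg hr.1]
    exact hr.2
  let V : ℂ → ℂ := fun s => volForm (G s) (linPart (Φ s) ![1, 0]) (linPart (Φ s) ![0, 1])
  have hV : ContinuousOn V (Metric.closedBall 0 1) :=
    ContinuousOn.volForm h.continuousOn_form (ContinuousOn.linPart h.continuousOn continuousOn_const)
      (ContinuousOn.linPart h.continuousOn continuousOn_const)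
  have hV0 (s) (hs : s ∈ Metric.closedBall (0 : ℂ) 1) : V s ≠ 0 := by
    -- The case τ = 0 for the standard basis says that the linear part of a symplectic map is
    -- invertible onto the kernel.
    have := volForm_interpolation_ne_zero (h.form_ne_zero s hs) (h.symplectic s hs)
      (h.linForm_apply s hs) (a := ![1, 0]) (b := ![0, 1]) ?_ ?_ ?_ (τ := 0) (by simp)
    · simpa using this
    · have : (nsq ![(1 : ℂ), 0] : ℂ) = 1 := by rw [← herm_self]; simp [herm_eq_sum]
      exact_mod_cast this
    · have : (nsq ![(0 : ℂ), 1] : ℂ) = 1 := by rw [← herm_self]; simp [herm_eq_sum]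
      exact_mod_cast this
    · simp [herm_eq_sum]
  have he : Continuous (fun x : ℝ × ℝ => (x.1 : ℂ) * Complex.exp (Complex.I * x.2)) := by fun_prop
  -- Radial contraction: at r = 0 the loop is the constant V 0, so its boundary value is that
  -- constant times an exponential.
  have hF : ContinuousOn (Function.uncurry fun r t : ℝ => V (r * Complex.exp (Complex.I * t)))
      (Set.Icc 0 1 ×ˢ Set.Icc 0 (2 * Real.pi)) :=
    hV.comp he.continuousOn fun x hx => hball _ _ hx.1
  obtain ⟨l, hl, hlF, hlp⟩ := exists_log_of_homotopy isCompact_Icc hF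
    fun r hr t _ => hV0 _ (hball r t hr)
  refine ⟨V 0, l, hV0 0 (by simp), hl, hlp _ _ fun r => by rw [exp_I_mul_two_pi], fun t ht => ?_⟩
  have := hlF t ht
  simpa only [Complex.ofReal_one, one_mul, Complex.ofReal_zero, zero_mul] using this

/-- Along the boundary of the disc, the volume of a unitary frame and its determinant differ by a
function with periodic logarithm. -/
theorem IsSymplecticFamily.exists_log_frame {Φ : ℂ → (Fin 2 → ℂ) →L[ℝ] (Fin 3 → ℂ)}
    {G : ℂ → Fin 3 → ℂ} (h : IsSymplecticFamily Φ G) {a b : ℝ → Fin 2 → ℂ}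
    (ha : ContinuousOn a (Set.Icc 0 (2 * Real.pi))) (hb : ContinuousOn b (Set.Icc 0 (2 * Real.pi)))
    (hap : a (2 * Real.pi) = a 0) (hbp : b (2 * Real.pi) = b 0)
    (ha1 : ∀ t ∈ Set.Icc 0 (2 * Real.pi), nsq (a t) = 1)
    (hb1 : ∀ t ∈ Set.Icc 0 (2 * Real.pi), nsq (b t) = 1)
    (hab : ∀ t ∈ Set.Icc 0 (2 * Real.pi), herm (a t) (b t) = 0) :
    ∃ (k : ℂ) (l : ℝ → ℂ), k ≠ 0 ∧ ContinuousOn l (Set.Icc 0 (2 * Real.pi)) ∧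
      l (2 * Real.pi) = l 0 ∧ ∀ t ∈ Set.Icc 0 (2 * Real.pi),
        volForm (G (Complex.exp (Complex.I * t))) (Φ (Complex.exp (Complex.I * t)) (a t))
          (Φ (Complex.exp (Complex.I * t)) (b t)) =
        k * Complex.exp (l t) * (colMatrix (a t) (b t)).det := by
  obtain ⟨k, l₁, hk, hl₁, hl₁p, hl₁V⟩ := h.exists_log_linPart
  have hm : Set.MapsTo (fun x : ℝ × ℝ => Complex.exp (Complex.I * x.2))
    (Set.Icc (0 : ℝ) 1 ×ˢ Set.Icc 0 (2 * Real.pi)) (Metric.closedBall 0 1) :=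
    fun x _ => exp_I_mul_mem_closedBall _
  have he : ContinuousOn (fun x : ℝ × ℝ => Complex.exp (Complex.I * x.2))
    (Set.Icc (0 : ℝ) 1 ×ˢ Set.Icc 0 (2 * Real.pi)) := by fun_prop
  have hτ : ContinuousOn (fun x : ℝ × ℝ => (x.1 : ℂ))
    (Set.Icc (0 : ℝ) 1 ×ˢ Set.Icc 0 (2 * Real.pi)) := by fun_prop
  have hΦ' := h.continuousOn.comp he hm
  have hsnd : Set.MapsTo (fun x : ℝ × ℝ => x.2) (Set.Icc (0 : ℝ) 1 ×ˢ Set.Icc 0 (2 * Real.pi))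
    (Set.Icc 0 (2 * Real.pi)) := fun x hx => hx.2
  have hpart {a : ℝ → Fin 2 → ℂ} (ha : ContinuousOn a (Set.Icc 0 (2 * Real.pi))) :
      ContinuousOn (fun x : ℝ × ℝ => linPart (Φ (Complex.exp (Complex.I * x.2))) (a x.2) +
        (x.1 : ℂ) • antiPart (Φ (Complex.exp (Complex.I * x.2))) (a x.2))
        (Set.Icc (0 : ℝ) 1 ×ˢ Set.Icc 0 (2 * Real.pi)) := by
    have ha' := ha.comp continuousOn_snd hsnd
    exact (ContinuousOn.linPart hΦ' ha').add (hτ.smul (ContinuousOn.antiPart hΦ' ha'))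
  have hF := ContinuousOn.volForm (h.continuousOn_form.comp he hm) (hpart ha) (hpart hb)
  -- The second homotopy runs from the linear part at τ = 0, where the volume factors through the
  -- determinant, to Φ itself at τ = 1.
  obtain ⟨l₂, hl₂, hl₂F, hl₂p⟩ := exists_log_of_homotopy isCompact_Icc
    (F := fun τ t => volForm (G (Complex.exp (Complex.I * t)))
      (linPart (Φ (Complex.exp (Complex.I * t))) (a t) +
        (τ : ℂ) • antiPart (Φ (Complex.exp (Complex.I * t))) (a t))
      (linPart (Φ (Complex.exp (Complex.I * t))) (b t) +
        (τ : ℂ) • antiPart (Φ (Complex.exp (Complex.I * t))) (b t))) hF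
    fun r hr t ht => volForm_interpolation_ne_zero (h.form_ne_zero _ (exp_I_mul_mem_closedBall t))
      (h.symplectic _ (exp_I_mul_mem_closedBall t)) (h.linForm_apply _ (exp_I_mul_mem_closedBall t))
      (ha1 t ht) (hb1 t ht) (hab t ht) hr
  refine ⟨k, fun t => l₁ t + l₂ t, hk, hl₁.add hl₂, ?_, fun t ht => ?_⟩
  · have := hl₂p (2 * Real.pi) 0 fun r => by rw [exp_I_mul_two_pi, hap, hbp]
    simp only [this, hl₁p]
  · have e := hl₂F t ht
    simp only [Complex.ofReal_one, one_smul, linPart_add_antiPart, Complex.ofReal_zero, zero_smul,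
      add_zero] at e
    rw [e, volForm_linPart, hl₁V t ht, Complex.exp_add]
    ring

theorem volForm_sub_smul (g u v : Fin 3 → ℂ) (r : ℝ) :
    volForm g u (v - r • u) = volForm g u v := by
  simp [volForm_apply]; ring

/-- A loop of Lagrangian planes along the boundary of the disc on which the volume form has
constant phase has Maslov index zero with respect to any symplectic trivialization. -/
theorem IsSymplecticFamily.hasMaslovIndex_zero {Φ : ℂ → (Fin 2 → ℂ) →L[ℝ] (Fin 3 → ℂ)}
    {G : ℂ → Fin 3 → ℂ} (h : IsSymplecticFamily Φ G) {x y : ℝ → Fin 2 → ℂ}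
    {L : ℝ → Submodule ℝ (Fin 2 → ℂ)} {c : ℂ}
    (hx : ContinuousOn x (Set.Icc 0 (2 * Real.pi))) (hy : ContinuousOn y (Set.Icc 0 (2 * Real.pi)))
    (hxp : x (2 * Real.pi) = x 0) (hyp : y (2 * Real.pi) = y 0)
    (hxy : ∀ t ∈ Set.Icc 0 (2 * Real.pi), stdForm (x t) (y t) = 0) (hc : c ≠ 0)
    (hvol : ∀ t ∈ Set.Icc 0 (2 * Real.pi), volForm (G (Complex.exp (Complex.I * t)))
      (Φ (Complex.exp (Complex.I * t)) (x t)) (Φ (Complex.exp (Complex.I * t)) (y t)) = c)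
    (hL : ∀ t ∈ Set.Icc 0 (2 * Real.pi), L t = Submodule.span ℝ {x t, y t}) :
    HasMaslovIndex L 0 := by
  set K := Set.Icc 0 (2 * Real.pi) with hK
  have hvolm (t) (ht : t ∈ K) : volForm (G (Complex.exp (Complex.I * t)))
      (Φ (Complex.exp (Complex.I * t)) (x t))
      (Φ (Complex.exp (Complex.I * t)) (gramVec (x t) (y t))) = c := by
    rw [gramVec, map_sub, map_smul, volForm_sub_smul, hvol t ht]
  have hx0 (t) (ht : t ∈ K) : x t ≠ 0 := by
    intro h0
    have := hvol t ht
    rw [h0, map_zero, map_zero] at this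
    exact hc this.symm
  have hy0 (t) (ht : t ∈ K) : gramVec (x t) (y t) ≠ 0 := by
    intro h0
    have h1 := hvolm t ht
    rw [h0, map_zero, map_zero] at h1
    exact hc h1.symm
  have ha : ContinuousOn (fun t => unitVec (x t)) K := ContinuousOn.unitVec hx hx0
  have hb : ContinuousOn (fun t => unitVec (gramVec (x t) (y t))) K :=
    ContinuousOn.unitVec (ContinuousOn.gramVec hx hy hx0) hy0
  have ha1 (t) (ht : t ∈ K) : nsq (unitVec (x t)) = 1 := nsq_unitVec (hx0 t ht)
  have hb1 (t) (ht : t ∈ K) : nsq (unitVec (gramVec (x t) (y t))) = 1 := nsq_unitVec (hy0 t ht)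
  have hab (t) (ht : t ∈ K) := herm_unitVec_gramVec (hx0 t ht) (hxy t ht)
  obtain ⟨k, l, hk, hl, hlp, hlV⟩ := h.exists_log_frame ha hb (by simp only [hxp])
    (by simp only [hxp, hyp]) ha1 hb1 hab
  have hρ (t) (ht : t ∈ K) : 0 < (√(nsq (x t)))⁻¹ * (√(nsq (gramVec (x t) (y t))))⁻¹ :=
    mul_pos (inv_pos.2 (Real.sqrt_pos.2 (nsq_pos (hx0 t ht))))
      (inv_pos.2 (Real.sqrt_pos.2 (nsq_pos (hy0 t ht))))
  -- Normalization changes the volume c only by positive factors, so the phase of the determinant is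
  -- that of (c / k) · exp(−l), which has a periodic argument.
  have hdet (t) (ht : t ∈ K) : (colMatrix (unitVec (x t)) (unitVec (gramVec (x t) (y t)))).det =
      (((√(nsq (x t)))⁻¹ * (√(nsq (gramVec (x t) (y t))))⁻¹ : ℝ) : ℂ) *
        Complex.exp (Complex.log (c / k) - l t) := by
    have e := hlV t ht
    have hu (w : Fin 2 → ℂ) : Φ (Complex.exp (Complex.I * t)) (unitVec w) =
        (((√(nsq w))⁻¹ : ℝ) : ℂ) • Φ (Complex.exp (Complex.I * t)) w := by
      rw [unitVec, map_smul, real_smul_eq]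
    rw [hu, hu, volForm_smul_smul, hvolm t ht] at e
    rw [Complex.exp_sub, Complex.exp_log (div_ne_zero hc hk), Complex.ofReal_mul, div_div,
      ← mul_div_assoc, e, mul_div_cancel_left₀ _ (mul_ne_zero hk (Complex.exp_ne_zero _))]
  refine ⟨fun t => colMatrix (unitVec (x t)) (unitVec (gramVec (x t) (y t))),
    fun t => 2 * (Complex.log (c / k) - l t).im, ContinuousOn.colMatrix ha hb, ?_, ?_, ?_⟩
  · exact continuousOn_const.mul
      (Complex.continuous_im.comp_continuousOn (continuousOn_const.sub hl))
  · intro t ht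
    have hU := colMatrix_mem_unitaryGroup (ha1 t ht) (hb1 t ht) (hab t ht)
    refine ⟨hU, ?_, ?_⟩
    · rw [range_transpose_colMatrix, hL t ht]
      exact (span_unitVec_gramVec (hx0 t ht) (hy0 t ht)).symm
    · rw [eq_exp_of_norm_eq_one (hρ t ht) (norm_det_of_mem_unitaryGroup hU) (hdet t ht),
        ← Complex.exp_nat_mul]
      congr 1
      push_cast
      ring
  · simp only [hlp]
    simp

/-! ### The Maslov condition along the orbits. -/

/-- The inverse of a symplectic map `ℂ^k → ℂ^N` on its range. -/
def symplecticInv {k N : ℕ} (Φ : (Fin k → ℂ) →L[ℝ] (Fin N → ℂ)) (u : Fin N → ℂ) : Fin k → ℂ :=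
  fun j => (stdForm u (Φ (Pi.single j Complex.I)) : ℂ) -
    (stdForm u (Φ (Pi.single j 1)) : ℂ) * Complex.I

theorem symplecticInv_apply {k N : ℕ} {Φ : (Fin k → ℂ) →L[ℝ] (Fin N → ℂ)}
    (hΦ : ∀ a b, stdForm (Φ a) (Φ b) = stdForm a b) (a : Fin k → ℂ) :
    symplecticInv Φ (Φ a) = a := by
  ext j
  have h1 : stdForm a (Pi.single j Complex.I) = (a j).re := by
    simp [stdForm, Pi.single_apply, apply_ite]
  have h2 : stdForm a (Pi.single j 1) = -(a j).im := by
    simp [stdForm, Pi.single_apply, apply_ite]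
  rw [symplecticInv, hΦ, hΦ, h1, h2]
  push_cast
  rw [neg_mul, sub_neg_eq_add, Complex.re_add_im]

theorem continuous_stdForm {N : ℕ} :
    Continuous fun x : (Fin N → ℂ) × (Fin N → ℂ) => stdForm x.1 x.2 := by
  unfold stdForm
  fun_prop

theorem ContinuousOn.symplecticInv {X : Type*} [TopologicalSpace X] {s : Set X} {k N : ℕ}
    {Φ : X → (Fin k → ℂ) →L[ℝ] (Fin N → ℂ)} {u : X → Fin N → ℂ} (hΦ : ContinuousOn Φ s)
    (hu : ContinuousOn u s) : ContinuousOn (fun x => symplecticInv (Φ x) (u x)) s := by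
  have h (w : Fin k → ℂ) : ContinuousOn (fun x => (stdForm (u x) (Φ x w) : ℂ)) s :=
    Complex.continuous_ofReal.comp_continuousOn
      (continuous_stdForm.comp_continuousOn (hu.prodMk (hΦ.clm_apply continuousOn_const)))
  exact continuousOn_pi.2 fun j => (h _).sub ((h _).mul continuousOn_const)

theorem linForm_grad_rotation (n : ℕ) (θ : Real.Angle) (z v : Fin 3 → ℂ) :
    linForm (grad n (rotation θ z)) (rotation θ v) = linForm (grad n z) v := by
  simp only [linForm_apply, grad, rotation, Matrix.cons_val]
  linear_combination 2 * (z 0 * v 0 + z 1 * v 1) * sq_add_sq_cos_sin θ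

theorem stdForm_rotation (θ : Real.Angle) (u v : Fin 3 → ℂ) :
    stdForm (rotation θ u) (rotation θ v) = stdForm u v := by
  simp [stdForm, Fin.sum_univ_three, rotation]
  linear_combination ((u 0).re * (v 0).im - (u 0).im * (v 0).re + (u 1).re * (v 1).im -
    (u 1).im * (v 1).re) * θ.cos_sq_add_sin_sq

/-- The rotation is real of determinant one and `grad` is equivariant, so all three rows of the
determinant rotate together. -/
theorem volForm_rotation (n : ℕ) (θ : Real.Angle) (z u v : Fin 3 → ℂ) :
    volForm (grad n (rotation θ z)) (rotation θ u) (rotation θ v) = volForm (grad n z) u v := by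
  have h2 : (starRingEnd ℂ) (2 : ℂ) = 2 := map_ofNat _ 2
  simp [volForm_apply, grad, rotation, h2]
  linear_combination (2 * (starRingEnd ℂ) (z 0) * (u 1 * v 2 - u 2 * v 1) +
    2 * (starRingEnd ℂ) (z 1) * (u 2 * v 0 - u 0 * v 2) +
    ((n : ℂ) + 1) * (starRingEnd ℂ) (z 2) ^ n * (u 0 * v 1 - u 1 * v 0)) * sq_add_sq_cos_sin θ

/-- The volume form does not vanish on a Lagrangian plane. -/
theorem volForm_ne_zero_of_lagrangian {g u v : Fin 3 → ℂ} (hg : g ≠ 0) (hu : linForm g u = 0)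
    (hv : linForm g v = 0) (hu0 : u ≠ 0) (huv : v ∉ Submodule.span ℝ {u})
    (h : stdForm u v = 0) : volForm g u v ≠ 0 := by
  intro h0
  obtain ⟨x, y, hxy, hd⟩ := exists_dependence_of_volForm_eq_zero hg hu hv h0
  have hy : y ≠ 0 := by
    rintro rfl
    rw [zero_smul, add_zero, smul_eq_zero] at hd
    rcases hd with hd | hd
    · simp [hd] at hxy
    · exact hu0 hd
  have hvu : v = (-x / y) • u := by
    ext i
    have := congrFun hd i
    simp at this ⊢
    field_simp
    linear_combination this
  apply huv
  -- If v were a complex multiple of u, the Lagrangian condition would make the factor real, against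
  -- real independence.
  rw [hvu, stdForm_eq_im, herm_smul_right, herm_self, Complex.im_mul_ofReal, mul_eq_zero] at h
  have hz := h.resolve_right (nsq_pos hu0).ne'
  rw [hvu, Submodule.mem_span_singleton]
  refine ⟨(-x / y).re, ?_⟩
  rw [real_smul_eq]
  congr 1
  exact Complex.ext (by simp) (by simp [hz])

theorem maslovConditionAt_W {n : ℕ} {p : Fin 3 → ℂ} (hp : p ∈ W n)
    (hfix : p ∉ fixedPoints (W n) rotation) : MaslovConditionAt (W n) rotation p := by
  have hp01 : ¬(p 0 = 0 ∧ p 1 = 0) := fun h => hfix ⟨hp, rotation_fixes_iff.2 h⟩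
  refine ⟨2 * Real.pi, ⟨⟨by positivity, ?_⟩, ?_⟩, exists_disc hp hp01, ?_⟩
  · rw [Real.Angle.coe_two_pi, rotation_zero]
  · rintro t ⟨ht0, ht⟩
    have := (rotation_eq_self_iff.1 ht).resolve_right hp01
    obtain ⟨m, hm⟩ := Real.Angle.coe_eq_zero_iff.1 this
    rw [zsmul_eq_mul] at hm
    have hpi := Real.pi_pos
    have hm0 : 0 < m := by
      by_contra hcon
      have : (m : ℝ) ≤ 0 := by exact_mod_cast not_lt.1 hcon
      nlinarith
    have : (1 : ℝ) ≤ m := by exact_mod_cast hm0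
    nlinarith
  · intro v hv hvX hω ψ Φ hψ hΦ
    set X := generator rotation p with hX
    have hXT : X ∈ tangentVectors (W n) p := generator_mem_tangentVectors hp
    have hX0 : X ≠ 0 := by
      intro h
      rw [hX, generator_rotation] at h
      exact hp01 ⟨by simpa using congrFun h 1, by simpa using congrFun h 0⟩
    have hang (t : ℝ) : 2 * Real.pi * (t / (2 * Real.pi)) = t := by
      have := Real.pi_pos
      field_simp
    have hfd (θ : Real.Angle) {w : Fin 3 → ℂ} (hw : w ∈ tangentVectors (W n) p) :
        fderivWithin ℝ (rotation θ) (W n) p w = rotation θ w := by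
      rw [fderivWithin_apply_of_mem_tangentVectors (hasFDerivAt_rotation θ p).differentiableAt hw,
        (hasFDerivAt_rotation θ p).fderiv]
      rfl
    have hball := exp_I_mul_mem_closedBall
    have hbd (t : ℝ) : ψ (Complex.exp (Complex.I * t)) = rotation (t : Real.Angle) p := by
      rw [hψ.boundary, hang]
    have hinv (t : ℝ) {w : Fin 3 → ℂ} (hw : w ∈ tangentVectors (W n) p) :
        Φ (Complex.exp (Complex.I * t)) (symplecticInv (Φ (Complex.exp (Complex.I * t)))
          (rotation (t : Real.Angle) w)) = rotation (t : Real.Angle) w := by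
      have h1 : rotation (t : Real.Angle) w ∈ Set.range (Φ (Complex.exp (Complex.I * t))) := by
        rw [hΦ.range_eq _ (hball t), hbd, tangentVectors_W (rotation_mem_W _ hp)]
        rw [tangentVectors_W hp] at hw
        exact (linForm_grad_rotation _ _ _ _).trans hw
      obtain ⟨a, ha⟩ := h1
      rw [← ha, symplecticInv_apply (hΦ.symplectic _ (hball t))]
    have hcr (w : Fin 3 → ℂ) : Continuous fun t : ℝ => rotation (t : Real.Angle) w :=
      contDiff_rotation.continuous.comp (by fun_prop : Continuous fun t : ℝ => (t, w))
    have hce : Continuous fun t : ℝ => Complex.exp (Complex.I * t) := by fun_prop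
    have hcΦ : ContinuousOn (fun t : ℝ => Φ (Complex.exp (Complex.I * t)))
        (Set.Icc 0 (2 * Real.pi)) :=
      hΦ.smooth.continuousOn.comp hce.continuousOn fun t _ => hball t
    have hper (w : Fin 3 → ℂ) :
        symplecticInv (Φ (Complex.exp (Complex.I * ((2 * Real.pi : ℝ) : ℂ))))
          (rotation ((2 * Real.pi : ℝ) : Real.Angle) w) =
        symplecticInv (Φ (Complex.exp (Complex.I * ((0 : ℝ) : ℂ))))
          (rotation ((0 : ℝ) : Real.Angle) w) := by
      rw [exp_I_mul_two_pi, Real.Angle.coe_two_pi, Real.Angle.coe_zero]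
    have hgc : Continuous (grad n) := by unfold grad; fun_prop
    have hXk := hXT
    have hvk := hv
    rw [tangentVectors_W hp] at hXk hvk
    have hfam : IsSymplecticFamily Φ fun s => grad n (ψ s) :=
      { continuousOn := hΦ.smooth.continuousOn
        continuousOn_form := hgc.comp_continuousOn hψ.smooth.continuousOn
        form_ne_zero := fun s hs => grad_ne_zero (hψ.mapsTo s hs)
        linForm_apply := fun s hs a => by
          have : Φ s a ∈ Set.range (Φ s) := ⟨a, rfl⟩
          rw [hΦ.range_eq s hs, tangentVectors_W (hψ.mapsTo s hs)] at this
          exact this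
        symplectic := hΦ.symplectic }
    -- The transported vectors X and v, read in the trivialization, form a continuous closed frame
    -- on which Ω keeps its value at p.
    refine hfam.hasMaslovIndex_zero
      (x := fun t => symplecticInv (Φ (Complex.exp (Complex.I * t))) (rotation (t : Real.Angle) X))
      (y := fun t => symplecticInv (Φ (Complex.exp (Complex.I * t))) (rotation (t : Real.Angle) v))
      (c := volForm (grad n p) X v)
      (ContinuousOn.symplecticInv hcΦ (hcr X).continuousOn)
      (ContinuousOn.symplecticInv hcΦ (hcr v).continuousOn) (hper X) (hper v) ?_
      (volForm_ne_zero_of_lagrangian (grad_ne_zero hp) hXk hvk hX0 hvX hω) ?_ ?_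
    · intro t _
      rw [← hΦ.symplectic _ (hball t), hinv t hXT, hinv t hv, stdForm_rotation, hω]
    · intro t _
      rw [hinv t hXT, hinv t hv, hbd, volForm_rotation]
    · intro t _
      have hinj : Function.Injective (Φ (Complex.exp (Complex.I * t))).toLinearMap :=
        Function.LeftInverse.injective (g := symplecticInv (Φ (Complex.exp (Complex.I * t))))
          (symplecticInv_apply (hΦ.symplectic _ (hball t)))
      rw [orbitPlane, hang, hfd _ hXT, hfd _ hv, ← Submodule.comap_map_eq_of_injective hinj
        (Submodule.span ℝ _), Submodule.map_span, Set.image_pair]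
      congr 3
      · exact (hinv t hXT).symm
      · exact congrArg _ (hinv t hv).symm

theorem isSpecialHamiltonianAction_W (n : ℕ) : IsSpecialHamiltonianAction (W n) rotation where
  symplectic := isSymplecticFourManifold_W n
  connected := isConnected_W n
  chern := firstChernClassVanishes_W n
  action := isSmoothCircleAction_rotation fun θ _ hp => rotation_mem_W θ hp
  effective _ h := effective_rotation_W h
  fixed_nonempty := by
    rw [fixedPoints_W]
    exact ⟨_, 0, n.zero_le, rfl⟩
  exists_momentMap := ⟨_, isMomentMap_rotation⟩
  maslov _ hp hfix := maslovConditionAt_W hp hfix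

end SpecialHam

end

theorem proposition1p3 (n : ℕ) :
    SpecialHam.IsSmoothCircleAction Set.univ SpecialHam.rotation ∧
    (∀ θ : Real.Angle, SpecialHam.rotation θ '' SpecialHam.W n = SpecialHam.W n) ∧
    SpecialHam.IsSpecialHamiltonianAction (SpecialHam.W n) SpecialHam.rotation ∧
    SpecialHam.fixedPoints (SpecialHam.W n) SpecialHam.rotation =
      {p | ∃ k : ℕ, k ≤ n ∧
        p = ![0, 0, Complex.exp (2 * (Real.pi : ℂ) * Complex.I / ((n : ℂ) + 1)) ^ k]} ∧
    (SpecialHam.fixedPoints (SpecialHam.W n) SpecialHam.rotation).ncard = n + 1 :=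
  ⟨SpecialHam.isSmoothCircleAction_rotation fun _ _ _ => trivial, SpecialHam.rotation_image_W n,
    SpecialHam.isSpecialHamiltonianAction_W n, SpecialHam.fixedPoints_W n,
    SpecialHam.ncard_fixedPoints_W n⟩
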